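/- Let $p$ be a prime and $N\ge 1$ an integer. **Group.** Let $\mathfrak G$ be the $p$-adic Vilenkin group: the sequences $x=(x_k)_{k\in\mathbb Z}$ with $x_k\in\mathbb Z/p$ and only finitely many $x_k\neq 0$ with $k<0$, under coordinatewise addition $\dot+$, with the cosets of the subgroups $\mathfrak G_n=\{x: x_k=0 \text{ for } k<n\}$ ($n\in\mathbb Z$) as a base of the topology. Let $g_n$ be the sequence with $1$ at place $n$ and $0$ elsewhere, let $(\mathcal A x)_k=x_{k+1}$ (so $\mathcal A g_n=g_{n-1}$), and let $\mu$ be the Haar measure with $\mu(\mathfrak G_0)=1$. For $s\in\mathbb N$ let $H_0^{(s)}=\{a_{-1}g_{-1}\dot+\cdots\dot+a_{-s}g_{-s}: 0\le a_j\le p-1\}$, and $H_0=\bigcup_s H_0^{(s)}$. Let $X$ be the group of continuous characters of $\mathfrak G$, write $(\chi,x)$ for the value of $\chi$ at $x$, put $\mathfrak G_n^\perp=\{\chi\in X: (\chi,x)=1 \text{ for all } x\in \mathfrak G_n\}$, let $\nu$ be the Haar measure on $X$ with $\nu(\mathfrak G_0^\perp)=1$, let $(\chi\mathcal A^n,x)=(\chi,\mathcal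 A^nx)$ for $n\in\mathbb Z$, and let $r_n\in X$ be given by $(r_n,x)=e^{2\pi i x_n/p}$. **Tree and mask.** Let $T$ be an $N$-valid tree: a rooted tree with vertices labelled by $0,\dots,p-1$, in which the root and all vertices of levels $1,\dots,N-1$ have label $0$, and in which every word of $N$ labels is read along exactly one path of $N$ vertices directed away from the root. Let $\tilde E\subset \mathfrak G_1^\perp$ be the union of $\mathfrak G_{-N}^\perp$ and of all cosets $\mathfrak G_{-N}^\perp r_{-N}^{\alpha_{-N}}\cdots r_{-1}^{\alpha_{-1}}r_0^{\alpha_0}$ for which $\alpha_0\to\alpha_{-1}\to\dots\to\alpha_{-N}$ is a path of $T$ directed away from the root. Let $m_0:X\to\mathbb C$ be a mask generated by $T$, that is: $m_0$ is constant on cosets of $\mathfrak G_{-N}^\perp$, $m_0=1$ on $\mathfrak G_{-N}^\perp$, $|m_0|=1$ on $\tilde E$, $m_0=0$ on $\mathfrak G_1^\perp\setminus\tilde E$, and $m_0(\chi r_1^{\alpha_1}\cdots r_s^{\alpha_s})=m_0(\chi)$ for all $\chi\in X$, $s\in\mathbb N$ and $\alpha_1,\dots,\alpha_s$. Put $$\hat\varphi(\chi)=\prod_{n=0}^\infty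 m_0(\chi\mathcal A^{-n}),\qquad \varphi(x)=\int_X\hat\varphi(\chi)(\chi,x)\,d\nu(\chi).$$ **Spaces.** For $n\in\mathbb Z$ let $V_n$ be the closed linear span in $L_2(\mathfrak G)$ of the functions $\varphi(\mathcal A^nx\dot-h)$, $h\in H_0$, and let $W_n$ be the orthogonal complement of $V_n$ in $V_{n+1}$. **Theorem 5.1.** One has $\varphi\in L_2(\mathfrak G)$ and $V_0\subset V_1$. There is exactly one family $(\beta_h)_{h\in H_0^{(N+1)}}$ of complex numbers with $$m_0(\chi)=\frac1p\sum_{h\in H_0^{(N+1)}}\beta_h\overline{(\chi\mathcal A^{-1},h)}\qquad(\chi\in X).$$ For $l=1,\dots,p-1$ put $m_l(\chi)=m_0(\chi r_0^{-l})$, $\beta_h^{(l)}=\beta_h\,(r_0^l,\mathcal A^{-1}h)$ and $$\psi_l(x)=\sum_{h\in H_0^{(N+1)}}\beta_h^{(l)}\varphi(\mathcal Ax\dot-h).$$ Then $m_l(\chi)=\frac1p\sum_{h\in H_0^{(N+1)}}\beta^{(l)}_h\overline{(\chi\mathcal A^{-1},h)}$ for all $\chi\in X$, and the functions $\psi_l(x\dot-h)$,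 $l=1,\dots,p-1$, $h\in H_0$, form an orthonormal basis of $W_0$. -/

import Mathlib

open MeasureTheory

noncomputable section

namespace Vilenkin

/-! ### The `p`-adic Vilenkin group -/

/-- Two-sided sequences over `ℤ/p` with only finitely many nonzero terms of negative index, as a
subgroup of all two-sided sequences under coordinatewise addition. -/
def sequences (p : ℕ) : AddSubgroup (ℤ → ZMod p) where
  carrier := {x | ∃ m : ℤ, ∀ k < m, x k = 0}
  zero_mem' := ⟨0, fun _ _ => rfl⟩
  add_mem' := by
    rintro x y ⟨m, hm⟩ ⟨n, hn⟩
    refine ⟨min m n, fun k hk => ?_⟩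
    simp [hm k (lt_of_lt_of_le hk (min_le_left _ _)), hn k (lt_of_lt_of_le hk (min_le_right _ _))]
  neg_mem' := by
    rintro x ⟨m, hm⟩
    exact ⟨m, fun k hk => by simp [hm k hk]⟩

/-- The `p`-adic Vilenkin group `𝔊`. (A type of its own, so that it does not inherit the product
topology.) -/
def VilenkinGroup (p : ℕ) : Type := sequences p

instance (p : ℕ) : AddCommGroup (VilenkinGroup p) :=
  inferInstanceAs (AddCommGroup (sequences p))

variable {p : ℕ}

/-- The `k`-th coordinate, as a homomorphism. -/
def coord (k : ℤ) : VilenkinGroup p →+ ZMod p :=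
  (Pi.evalAddMonoidHom (fun _ : ℤ => ZMod p) k).comp (sequences p).subtype

lemma ext_coord {x y : VilenkinGroup p} (h : ∀ k, coord k x = coord k y) : x = y :=
  Subtype.ext (funext h)

/-- The subgroup `𝔊_n` of the basic chain: sequences vanishing at all indices `< n`. -/
def Gsub (p : ℕ) (n : ℤ) : AddSubgroup (VilenkinGroup p) where
  carrier := {x | ∀ k < n, coord k x = 0}
  zero_mem' := fun _ _ => map_zero _
  add_mem' := fun {x y} hx hy k hk => by rw [map_add, hx k hk, hy k hk, add_zero]
  neg_mem' := fun {x} hx k hk => by rw [map_neg, hx k hk, neg_zero]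

lemma mem_Gsub {n : ℤ} {x : VilenkinGroup p} : x ∈ Gsub p n ↔ ∀ k < n, coord k x = 0 := Iff.rfl

/-- The subgroups `𝔊_n` form a basis of neighbourhoods of zero of a group topology. -/
@[reducible] def chainBasis (p : ℕ) : AddGroupFilterBasis (VilenkinGroup p) :=
  addGroupFilterBasisOfComm (Set.range fun n : ℤ => (Gsub p n : Set (VilenkinGroup p)))
    (Set.range_nonempty _)
    (by
      rintro _ _ ⟨m, rfl⟩ ⟨n, rfl⟩
      exact ⟨_, ⟨max m n, rfl⟩, fun x hx =>
        ⟨fun k hk => hx k (lt_max_of_lt_left hk), fun k hk => hx k (lt_max_of_lt_right hk)⟩⟩)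
    (by
      rintro _ ⟨m, rfl⟩
      exact (Gsub p m).zero_mem)
    (by
      rintro _ ⟨m, rfl⟩
      refine ⟨_, ⟨m, rfl⟩, ?_⟩
      rintro _ ⟨x, hx, y, hy, rfl⟩
      exact (Gsub p m).add_mem hx hy)
    (by
      rintro _ ⟨m, rfl⟩
      exact ⟨_, ⟨m, rfl⟩, fun x hx => (Gsub p m).neg_mem hx⟩)

/-- The topology whose base consists of all cosets of the subgroups `𝔊_n`. -/
instance : TopologicalSpace (VilenkinGroup p) := (chainBasis p).topology

instance : IsTopologicalAddGroup (VilenkinGroup p) := (chainBasis p).isTopologicalAddGroup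

lemma hasBasis_zero :
    (nhds (0 : VilenkinGroup p)).HasBasis (fun _ : ℤ => True) fun n => (Gsub p n : Set _) := by
  refine ⟨fun t => ?_⟩
  rw [(chainBasis p).nhds_zero_hasBasis.mem_iff]
  constructor
  · rintro ⟨_, ⟨n, rfl⟩, h⟩
    exact ⟨n, trivial, h⟩
  · rintro ⟨n, -, h⟩
    exact ⟨_, ⟨n, rfl⟩, h⟩

/-- The homomorphism sending a one-sided sequence to the corresponding element of `𝔊_0`. -/
def ofNat (p : ℕ) : (ℕ → ZMod p) →+ VilenkinGroup p where
  toFun a := ⟨fun k => if 0 ≤ k then a k.toNat else 0, 0, fun k hk => if_neg (not_le.2 hk)⟩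
  map_zero' := by
    apply ext_coord
    intro k
    change (if 0 ≤ k then (0 : ZMod p) else 0) = 0
    simp
  map_add' a b := by
    apply ext_coord
    intro k
    change (if 0 ≤ k then a k.toNat + b k.toNat else 0)
      = (if 0 ≤ k then a k.toNat else 0) + (if 0 ≤ k then b k.toNat else 0)
    split_ifs <;> simp

lemma coord_ofNat (a : ℕ → ZMod p) (k : ℤ) :
    coord k (ofNat p a) = if 0 ≤ k then a k.toNat else 0 := rfl

lemma continuous_ofNat : Continuous (ofNat p) := by
  refine continuous_of_continuousAt_zero (ofNat p) ?_
  rw [ContinuousAt, map_zero, hasBasis_zero.tendsto_right_iff]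
  intro n _
  have hopen : IsOpen {a : ℕ → ZMod p | ∀ i ∈ Finset.range n.toNat, a i = 0} := by
    have : {a : ℕ → ZMod p | ∀ i ∈ Finset.range n.toNat, a i = 0}
        = ⋂ i ∈ Finset.range n.toNat, (fun a : ℕ → ZMod p => a i) ⁻¹' {0} := by
      ext a
      simp
    rw [this]
    exact isOpen_biInter_finset fun i _ => (isOpen_discrete _).preimage (continuous_apply i)
  filter_upwards [hopen.mem_nhds (fun _ _ => rfl)] with a ha k hk
  rw [coord_ofNat]
  split_ifs with h
  · exact ha _ (Finset.mem_range.2 (by omega))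
  · rfl

lemma isCompact_Gsub_zero [Fact p.Prime] :
    IsCompact (Gsub p 0 : Set (VilenkinGroup p)) := by
  have h : (Gsub p 0 : Set (VilenkinGroup p)) = Set.range (ofNat p) := by
    ext x
    constructor
    · intro hx
      refine ⟨fun i => coord i x, ext_coord fun k => ?_⟩
      rw [coord_ofNat]
      split_ifs with hk
      · rw [Int.toNat_of_nonneg hk]
      · exact (hx k (not_le.1 hk)).symm
    · rintro ⟨a, rfl⟩ k hk
      rw [coord_ofNat, if_neg (not_le.2 hk)]
  rw [h]
  exact isCompact_range continuous_ofNat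

instance [Fact p.Prime] : LocallyCompactSpace (VilenkinGroup p) :=
  isCompact_Gsub_zero.locallyCompactSpace_of_mem_nhds_of_addGroup
    (hasBasis_zero.mem_of_mem (i := 0) trivial)

instance : MeasurableSpace (VilenkinGroup p) := borel _
instance : BorelSpace (VilenkinGroup p) := ⟨rfl⟩

/-- The Haar measure `μ` on `𝔊`, normalised by `μ(𝔊_0) = 1`. -/
def haarG (p : ℕ) [Fact p.Prime] : Measure (VilenkinGroup p) :=
  Measure.addHaarMeasure
    { carrier := (Gsub p 0 : Set (VilenkinGroup p))
      isCompact' := isCompact_Gsub_zero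
      interior_nonempty' :=
        ⟨0, mem_interior_iff_mem_nhds.2 (hasBasis_zero.mem_of_mem (i := 0) trivial)⟩ }

/-- The element `g_n` of the basic system: the sequence with `1` at place `n`, `0` elsewhere. -/
def g (p : ℕ) (n : ℤ) : VilenkinGroup p :=
  ⟨Pi.single n 1, n, fun _ hk => Pi.single_eq_of_ne hk.ne 1⟩

/-- `H_0^{(s)}`: the elements `a_{-1} g_{-1} + ⋯ + a_{-s} g_{-s}`. -/
def H0s (p : ℕ) [Fact p.Prime] (s : ℕ) : Finset (VilenkinGroup p) :=
  open Classical in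
  Finset.univ.image fun a : Fin s → Fin p => ∑ j : Fin s, (a j : ℕ) • g p (-((j : ℤ) + 1))

/-- `H_0`, the union of all the sets `H_0^{(s)}`. -/
def H0 (p : ℕ) [Fact p.Prime] : Set (VilenkinGroup p) :=
  {h | ∃ s : ℕ, h ∈ H0s p s}

/-- The `n`-th power `𝒜ⁿ` (`n ∈ ℤ`) of the dilation operator
`𝒜 (∑ a_k g_k) = ∑ a_k g_{k-1}`: its `k`-th coordinate is `(𝒜ⁿ x)_k = x_{k+n}`. -/
def dilation (p : ℕ) (n : ℤ) : VilenkinGroup p →ₜ+ VilenkinGroup p where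
  toFun x := ⟨fun k => coord (k + n) x, by
    obtain ⟨m, hm⟩ := x.2
    exact ⟨m - n, fun k hk => hm _ (by omega)⟩⟩
  map_zero' := ext_coord fun _ => rfl
  map_add' _ _ := ext_coord fun _ => rfl
  continuous_toFun := by
    let f : VilenkinGroup p →+ VilenkinGroup p :=
      { toFun := fun x => ⟨fun k => coord (k + n) x, by
          obtain ⟨m, hm⟩ := x.2
          exact ⟨m - n, fun k hk => hm _ (by omega)⟩⟩
        map_zero' := ext_coord fun _ => rfl
        map_add' := fun _ _ => ext_coord fun _ => rfl }
    refine continuous_of_continuousAt_zero f ?_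
    rw [ContinuousAt, map_zero, hasBasis_zero.tendsto_iff hasBasis_zero]
    exact fun m _ => ⟨m + n, trivial, fun x hx k hk => hx (k + n) (by omega)⟩

lemma dilation_add (m n : ℤ) (x : VilenkinGroup p) :
    dilation p (m + n) x = dilation p m (dilation p n x) :=
  ext_coord fun k => by
    change coord (k + (m + n)) x = coord (k + m + n) x
    rw [add_assoc]

/-! ### Characters -/

/-- The group `X` of characters of `𝔊` (continuous homomorphisms to the unit circle). -/
abbrev CharGroup (p : ℕ) : Type := PontryaginDual (Multiplicative (VilenkinGroup p))

instance : MeasurableSpace (CharGroup p) := borel _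
instance : BorelSpace (CharGroup p) := ⟨rfl⟩

/-- The value `(χ, x)` of a character. -/
def pair (χ : CharGroup p) (x : VilenkinGroup p) : ℂ := (χ (Multiplicative.ofAdd x) : ℂ)

/-- The annihilator `𝔊_n^⊥`. -/
def annih (p : ℕ) (n : ℤ) : Set (CharGroup p) := {χ | ∀ x ∈ Gsub p n, pair χ x = 1}

/-- The Haar measure `ν` on `X`, normalised by `ν(𝔊_0^⊥) = 1`. -/
def haarX (p : ℕ) [Fact p.Prime] : Measure (CharGroup p) :=
  ((Measure.haar : Measure (CharGroup p)) (annih p 0))⁻¹ • Measure.haar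

lemma continuous_coord (n : ℤ) : Continuous (coord n : VilenkinGroup p →+ ZMod p) := by
  refine continuous_of_continuousAt_zero (coord n) ?_
  rw [ContinuousAt, map_zero, nhds_discrete (ZMod p), Filter.tendsto_pure]
  filter_upwards [hasBasis_zero.mem_of_mem (i := n + 1) trivial] with x hx
  exact hx n (by omega)

/-- The Rademacher character `r_n`, `(r_n, x) = exp (2 π i x_n / p)`. -/
def r (p : ℕ) [Fact p.Prime] (n : ℤ) : CharGroup p :=
  show Multiplicative (VilenkinGroup p) →ₜ* Circle from
  { toFun := fun x => ZMod.toCircle (coord n (Multiplicative.toAdd x))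
    map_one' := by simp
    map_mul' := fun x y => by simp [AddChar.map_add_eq_mul]
    continuous_toFun := by
      have h : Continuous (fun a : ZMod p => ZMod.toCircle a) := continuous_of_discreteTopology
      exact h.comp ((continuous_coord n).comp continuous_toAdd) }

/-- The character `χ𝒜ⁿ`, given by `(χ𝒜ⁿ, x) = (χ, 𝒜ⁿ x)`. -/
def charDilation (n : ℤ) (χ : CharGroup p) : CharGroup p :=
  PontryaginDual.map
    ({ toFun := fun x => Multiplicative.ofAdd (dilation p n (Multiplicative.toAdd x))
       map_one' := by simp
       map_mul' := fun x y => by simp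
       continuous_toFun :=
        continuous_ofAdd.comp ((dilation p n).continuous_toFun.comp continuous_toAdd) } :
      Multiplicative (VilenkinGroup p) →ₜ* Multiplicative (VilenkinGroup p)) χ

/-! ### `N`-valid trees, masks and the functions they generate -/

section Tree

variable (T : RootedTree) (label : T → ZMod p)

/-- A path `v 0 → v 1 → ⋯` of `n` vertices in a rooted tree, directed away from the root. -/
def IsPath {T : RootedTree} {n : ℕ} (v : Fin n → T) : Prop :=
  ∀ i j : Fin n, (i : ℕ) + 1 = j → v i ⋖ v j

/-- A rooted tree with vertices labelled by `0, …, p - 1` is `N`-valid if the root and all vertices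
of level `1, …, N - 1` are labelled by zero, and every word of `N` labels is read along exactly one
path of `N` vertices. (`Order.height v` is the level of the vertex `v`; the root has level `0`.) -/
structure IsNValid (N : ℕ) : Prop where
  label_eq_zero : ∀ v : T, Order.height v < (N : ℕ∞) → label v = 0
  existsUnique_path : ∀ w : Fin N → ZMod p, ∃! v : Fin N → T, IsPath v ∧ ∀ i, label (v i) = w i

/-- The set `Ẽ` of the tree: the union of all the cosets
`𝔊_{-N}^⊥ r_{-N}^{α_{-N}} ⋯ r_{-1}^{α_{-1}} r_0^{α_0}` for which `α_0 → α_{-1} → ⋯ → α_{-N}` is a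
path of the tree, together with the coset `𝔊_{-N}^⊥` itself (the cosets
`𝔊_{-N}^⊥ r_{-N}^0 ⋯ r_{-N+i}^0` coming from the `N` zeros at the root are all equal to it). -/
def treeSet [Fact p.Prime] (N : ℕ) : Set (CharGroup p) :=
  annih p (-N) ∪
    {χ | ∃ v : Fin (N + 1) → T, IsPath v ∧ ∃ ζ ∈ annih p (-N),
      χ = ζ * ∏ j : Fin (N + 1), r p (-(j : ℤ)) ^ (label (v j)).val}

/-- The mask `m₀ : X → ℂ` is generated by the tree: it is constant on the cosets of `𝔊_{-N}^⊥`,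
equal to `1` on `𝔊_{-N}^⊥`, of absolute value one on `Ẽ`, zero on `𝔊_1^⊥ \ Ẽ`, and periodic with
all periods `r_1^{α_1} ⋯ r_s^{α_s}`. -/
structure IsGeneratedMask [Fact p.Prime] (N : ℕ) (m₀ : CharGroup p → ℂ) : Prop where
  eq_one : ∀ χ ∈ annih p (-N), m₀ χ = 1
  const_coset : ∀ χ, ∀ ζ ∈ annih p (-N), m₀ (ζ * χ) = m₀ χ
  norm_eq_one : ∀ χ ∈ treeSet T label N, ‖m₀ χ‖ = 1
  eq_zero : ∀ χ ∈ annih p 1, χ ∉ treeSet T label N → m₀ χ = 0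
  periodic : ∀ (χ : CharGroup p) (s : ℕ) (α : ℕ → ℕ),
    m₀ (χ * ∏ j ∈ Finset.Icc 1 s, r p (j : ℤ) ^ α j) = m₀ χ

end Tree

/-- `φ̂(χ) = ∏_{n ≥ 0} m₀(χ𝒜⁻ⁿ)`. -/
def phiHat (m₀ : CharGroup p → ℂ) (χ : CharGroup p) : ℂ := ∏' n : ℕ, m₀ (charDilation (-(n : ℤ)) χ)

variable [Fact p.Prime]

/-- The refinable function `φ`, the inverse Fourier transform of `φ̂`. -/
def phi (m₀ : CharGroup p → ℂ) (x : VilenkinGroup p) : ℂ :=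
  ∫ χ, phiHat m₀ χ * pair χ x ∂(haarX p)

/-- The space `L₂(𝔊)`. -/
abbrev L2 (p : ℕ) [Fact p.Prime] : Type := Lp ℂ 2 (haarG p)

/-- `V_n`: the closed linear span in `L₂(𝔊)` of the functions `φ(𝒜ⁿ x - h)`, `h ∈ H_0`. -/
def V (φ : VilenkinGroup p → ℂ) (n : ℤ) : Submodule ℂ (L2 p) :=
  (Submodule.span ℂ {f : L2 p | ∃ h ∈ H0 p,
    f =ᵐ[haarG p] fun x => φ (dilation p n x - h)}).topologicalClosure

/-- The wavelet space `W_n`: the orthogonal complement of `V_n` in `V_{n+1}`. -/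
def W (φ : VilenkinGroup p → ℂ) (n : ℤ) : Submodule ℂ (L2 p) := V φ (n + 1) ⊓ (V φ n)ᗮ

/-- `m(χ) = (1/p) ∑_{h ∈ H_0^{(N+1)}} β_h \overline{(χ𝒜⁻¹, h)}` for all characters `χ`. -/
def IsMaskCoeff (N : ℕ) (m : CharGroup p → ℂ) (β : H0s p (N + 1) → ℂ) : Prop :=
  ∀ χ : CharGroup p, m χ = (1 / (p : ℂ)) *
    ∑ h : H0s p (N + 1), β h * (starRingEnd ℂ) (pair (charDilation (-1) χ) h)

/-- The shifted mask `m_l(χ) = m₀(χ r_0^{-l})`. -/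
def shiftedMask (m₀ : CharGroup p → ℂ) (l : ℕ) (χ : CharGroup p) : ℂ := m₀ (χ * (r p 0 ^ l)⁻¹)

/-- `β_h^{(l)} = β_h (r_0^l, 𝒜⁻¹ h)`. -/
def shiftedCoeff {N : ℕ} (β : H0s p (N + 1) → ℂ) (l : ℕ) (h : H0s p (N + 1)) : ℂ :=
  β h * pair (r p 0 ^ l) (dilation p (-1) h)

/-- `ψ(x) = ∑_{h ∈ H_0^{(N+1)}} b_h φ(𝒜x - h)`. -/
def psi {N : ℕ} (φ : VilenkinGroup p → ℂ) (b : H0s p (N + 1) → ℂ) (x : VilenkinGroup p) : ℂ :=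
  ∑ h : H0s p (N + 1), b h * φ (dilation p 1 x - h)

end Vilenkin

end

open Vilenkin

/-! The proof works with the digits of a character: `dig k χ` is defined by `(χ, g_k) = exp (2πi d /
p)`, and `χ` lies in `𝔊_n^⊥` exactly when its digits vanish at all places `k ≥ n`. The mask sees
only the digits at places `-N, …, 0`. Each word of `N` labels is read along one path only, so the
digits at `-1, …, -N` leave a single value of the digit at `0` for which `m₀ ≠ 0`, namely the label
just above that path (`IsGeneratedMask.norm_eq`). Iterating, `|φ̂|` is the indicator of a graph: the
digits at places `n ≥ 0` are the labels met while climbing from the path of the low word to the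
root, and zeros afterwards (`IsGeneratedMask.norm_phiHat`). Hence `φ̂` lives on `p^N` cosets of
`𝔊_{-N}^⊥`, one for each low word, with modulus one.

For such a function Parseval turns the inner product of two translates into a full character sum
over `(ℤ/p)^N`, so the `H_0`-translates are orthonormal (`IsDigitGraph.integral_translates`). The
transform of `ψ_l` is again of this kind, with the digit at `0` raised by `l`, so different `l`
modulo `p` have disjoint supports in frequency (`IsDigitGraph.integral_translates_eq_zero`). By the
refinement equation `l = 0` gives `φ` itself.

Completeness is a dimension count: for `s ≥ N` the `p · p^s` orthonormal functions `ψ_l(x - h)`, `0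
≤ l < p`, `h ∈ H_0^{(s)}`, lie in the span of the `p^{s+1}` functions `φ(𝒜x - k)`, `k ∈
H_0^{(s+1)}`, and therefore span it (`phiDilate_mem_span`). Removing `l = 0` leaves a basis of
`W_0`. The mask coefficients come from Fourier inversion on `(ℤ/p)^{N+1}`. -/

noncomputable section

namespace Vilenkin

variable {p : ℕ}

/-! ### Calculus of the pairing, dilations and coordinates. -/

lemma pair_add (χ : CharGroup p) (x y : VilenkinGroup p) : pair χ (x + y) = pair χ x * pair χ y := by
  simp only [pair, ofAdd_add, map_mul, Circle.coe_mul]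

lemma pair_zero (χ : CharGroup p) : pair χ 0 = 1 := by
  simp only [pair, ofAdd_zero, map_one, Circle.coe_one]

lemma pair_neg (χ : CharGroup p) (x : VilenkinGroup p) :
    pair χ (-x) = (starRingEnd ℂ) (pair χ x) := by
  simp only [pair, ofAdd_neg, map_inv, Circle.coe_inv_eq_conj]

lemma pair_sub (χ : CharGroup p) (x y : VilenkinGroup p) :
    pair χ (x - y) = pair χ x * (starRingEnd ℂ) (pair χ y) := by
  rw [sub_eq_add_neg, pair_add, pair_neg]

lemma pair_mul (χ χ' : CharGroup p) (x : VilenkinGroup p) :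
    pair (χ * χ') x = pair χ x * pair χ' x := rfl

lemma pair_one (x : VilenkinGroup p) : pair 1 x = 1 := rfl

lemma pair_inv (χ : CharGroup p) (x : VilenkinGroup p) :
    pair χ⁻¹ x = (starRingEnd ℂ) (pair χ x) :=
  Circle.coe_inv_eq_conj _

lemma norm_pair (χ : CharGroup p) (x : VilenkinGroup p) : ‖pair χ x‖ = 1 := Circle.norm_coe _

lemma pair_sum {ι : Type*} (s : Finset ι) (χ : CharGroup p) (x : ι → VilenkinGroup p) :
    pair χ (∑ i ∈ s, x i) = ∏ i ∈ s, pair χ (x i) := by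
  classical
  induction s using Finset.induction_on with
  | empty => simp [pair_zero]
  | insert a s ha ih => rw [Finset.sum_insert ha, pair_add, Finset.prod_insert ha, ih]

lemma pair_nsmul (χ : CharGroup p) (n : ℕ) (x : VilenkinGroup p) :
    pair χ (n • x) = pair χ x ^ n := by
  simp only [pair, ofAdd_nsmul, map_pow, Circle.coe_pow]

lemma pair_ext {χ χ' : CharGroup p} (h : ∀ x, pair χ x = pair χ' x) : χ = χ' :=
  PontryaginDual.ext fun a => Circle.ext (h (Multiplicative.toAdd a))

lemma pair_charDilation (n : ℤ) (χ : CharGroup p) (x : VilenkinGroup p) :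
    pair (charDilation n χ) x = pair χ (dilation p n x) := rfl

lemma coord_dilation (n k : ℤ) (x : VilenkinGroup p) :
    coord k (dilation p n x) = coord (k + n) x := rfl

lemma dilation_zero (x : VilenkinGroup p) : dilation p 0 x = x :=
  ext_coord fun k => by rw [coord_dilation, add_zero]

lemma charDilation_charDilation (m n : ℤ) (χ : CharGroup p) :
    charDilation m (charDilation n χ) = charDilation (m + n) χ :=
  pair_ext fun x => by
    rw [pair_charDilation, pair_charDilation, pair_charDilation, add_comm, dilation_add]

lemma charDilation_zero (χ : CharGroup p) : charDilation 0 χ = χ :=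
  pair_ext fun x => by rw [pair_charDilation, dilation_zero]

lemma charDilation_mul (n : ℤ) (χ χ' : CharGroup p) :
    charDilation n (χ * χ') = charDilation n χ * charDilation n χ' := rfl

lemma coord_g (k n : ℤ) : coord k (g p n) = if k = n then 1 else 0 := by
  change (Pi.single n 1 : ℤ → ZMod p) k = _
  rw [Pi.single_apply]

lemma dilation_g (n k : ℤ) : dilation p n (g p k) = g p (k - n) :=
  ext_coord fun j => by
    rw [coord_dilation, coord_g, coord_g]
    congr 1
    exact propext ⟨fun h => by omega, fun h => by omega⟩

lemma coord_sum {ι : Type*} (s : Finset ι) (k : ℤ) (x : ι → VilenkinGroup p) :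
    coord k (∑ i ∈ s, x i) = ∑ i ∈ s, coord k (x i) := map_sum _ _ _

lemma Gsub_anti {m n : ℤ} (h : m ≤ n) : Gsub p n ≤ Gsub p m :=
  fun _ hx k hk => hx k (hk.trans_le h)

lemma exists_mem_Gsub (x : VilenkinGroup p) : ∃ n, x ∈ Gsub p n := x.2

lemma isOpen_Gsub (n : ℤ) : IsOpen (Gsub p n : Set (VilenkinGroup p)) :=
  (Gsub p n).isOpen_of_mem_nhds (g := 0) (hasBasis_zero.mem_of_mem (i := n) trivial)

lemma isInducing_toContinuousMap : Topology.IsInducing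
    (fun χ : CharGroup p => (χ : Multiplicative (VilenkinGroup p) →ₜ* Circle).toContinuousMap) :=
  ContinuousMonoidHom.isInducing_toContinuousMap _ _

lemma measurableSet_Gsub (n : ℤ) : MeasurableSet (Gsub p n : Set (VilenkinGroup p)) :=
  (isOpen_Gsub n).measurableSet

lemma continuous_pair_right (χ : CharGroup p) : Continuous (pair χ) :=
  continuous_subtype_val.comp ((map_continuous χ).comp continuous_ofAdd)

lemma continuous_pair_left (x : VilenkinGroup p) : Continuous fun χ : CharGroup p => pair χ x := by
  have h : Continuous fun χ : CharGroup p => χ (Multiplicative.ofAdd x) :=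
    (continuous_eval_const (F := C(Multiplicative (VilenkinGroup p), Circle))
      (Multiplicative.ofAdd x)).comp
      isInducing_toContinuousMap.continuous
  exact continuous_subtype_val.comp h

variable [Fact p.Prime]

lemma pair_r (n : ℤ) (x : VilenkinGroup p) : pair (r p n) x = ZMod.toCircle (coord n x) := rfl

lemma toCircle_sum {ι : Type*} (s : Finset ι) (a : ι → ZMod p) :
    (ZMod.toCircle (∑ i ∈ s, a i) : ℂ) = ∏ i ∈ s, (ZMod.toCircle (a i) : ℂ) := by
  classical
  induction s using Finset.induction_on with
  | empty => simp
  | insert b s hb ih =>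
    rw [Finset.sum_insert hb, AddChar.map_add_eq_mul, Circle.coe_mul, Finset.prod_insert hb, ih]

/-! ### Digits of a character. -/

lemma nsmul_char (x : VilenkinGroup p) : p • x = 0 :=
  ext_coord fun k => by
    rw [map_nsmul, map_zero, nsmul_eq_mul, CharP.cast_eq_zero, zero_mul]

lemma pair_pow_char (χ : CharGroup p) (x : VilenkinGroup p) : pair χ x ^ p = 1 := by
  rw [← pair_nsmul, nsmul_char, pair_zero]

lemma exists_toCircle_eq {z : ℂ} (hz : z ^ p = 1) : ∃ a : ZMod p, z = ZMod.toCircle a := by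
  have hp : p ≠ 0 := (Fact.out : p.Prime).ne_zero
  obtain ⟨i, -, hi⟩ := (Complex.isPrimitiveRoot_exp p hp).eq_pow_of_pow_eq_one hz
  refine ⟨(i : ZMod p), ?_⟩
  rw [ZMod.toCircle_natCast, ← hi, ← Complex.exp_nat_mul]
  congr 1
  ring

lemma toCircle_coe_injective :
    Function.Injective fun a : ZMod p => (ZMod.toCircle a : ℂ) :=
  Circle.coe_injective.comp (ZMod.injective_toCircle)

/-- The `k`-th digit of a character: `(χ, g_k) = exp (2 π i d / p)`. -/
def dig (k : ℤ) (χ : CharGroup p) : ZMod p :=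
  (exists_toCircle_eq (pair_pow_char χ (g p k))).choose

lemma pair_g (k : ℤ) (χ : CharGroup p) : pair χ (g p k) = ZMod.toCircle (dig k χ) :=
  (exists_toCircle_eq (pair_pow_char χ (g p k))).choose_spec

lemma dig_eq_iff {k : ℤ} {χ : CharGroup p} {a : ZMod p} :
    dig k χ = a ↔ pair χ (g p k) = ZMod.toCircle a := by
  rw [pair_g]
  exact toCircle_coe_injective.eq_iff.symm

lemma dig_mul (k : ℤ) (χ χ' : CharGroup p) : dig k (χ * χ') = dig k χ + dig k χ' := by
  rw [dig_eq_iff, pair_mul, pair_g, pair_g, AddChar.map_add_eq_mul, Circle.coe_mul]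

lemma dig_one (k : ℤ) : dig k (1 : CharGroup p) = 0 := by
  rw [dig_eq_iff, pair_one, AddChar.map_zero_eq_one, Circle.coe_one]

/-- The `k`-th digit as a homomorphism. -/
def digHom (p : ℕ) [Fact p.Prime] (k : ℤ) : CharGroup p →* Multiplicative (ZMod p) where
  toFun χ := Multiplicative.ofAdd (dig k χ)
  map_one' := by rw [dig_one]; rfl
  map_mul' χ χ' := by rw [dig_mul]; rfl

lemma dig_inv (k : ℤ) (χ : CharGroup p) : dig k χ⁻¹ = -dig k χ := map_inv (digHom p k) χ

lemma dig_pow (k : ℤ) (χ : CharGroup p) (n : ℕ) : dig k (χ ^ n) = n * dig k χ := by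
  rw [← nsmul_eq_mul]
  exact map_pow (digHom p k) χ n

lemma dig_prod {ι : Type*} (s : Finset ι) (k : ℤ) (χ : ι → CharGroup p) :
    dig k (∏ i ∈ s, χ i) = ∑ i ∈ s, dig k (χ i) := map_prod (digHom p k) χ s

lemma dig_r (k n : ℤ) : dig k (r p n) = if k = n then 1 else 0 := by
  rw [dig_eq_iff, pair_r, coord_g]
  simp only [eq_comm]

lemma dig_charDilation (k n : ℤ) (χ : CharGroup p) :
    dig k (charDilation n χ) = dig (k - n) χ := by
  rw [dig_eq_iff, pair_charDilation, dilation_g, pair_g]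

/-- A neighbourhood of `1` containing no other `p`-th root of unity. Character values are `p`-th
roots of unity, so a character mapping a set into it is trivial on that set; this is how topology
turns into algebra below. -/
lemma isOpen_rootsOfUnity_compl :
    IsOpen {z : Circle | (z : ℂ) ^ p = 1 → z = 1} := by
  have h : {z : Circle | (z : ℂ) ^ p = 1 → z = 1}
      = (((ZMod.toCircle : AddChar (ZMod p) Circle) : ZMod p → Circle) '' {a | a ≠ 0})ᶜ := by
    ext z
    simp only [Set.mem_ofPred_eq, Set.mem_compl_iff, Set.mem_image, not_exists, not_and]
    constructor
    · rintro h a ha rfl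
      refine ha (ZMod.injective_toCircle ?_)
      rw [h, AddChar.map_zero_eq_one]
      rw [← Circle.coe_pow, ← AddChar.map_nsmul_eq_pow]
      simp
    · intro h hz
      obtain ⟨a, ha⟩ := exists_toCircle_eq hz
      have hz' : ZMod.toCircle a = z := Circle.ext ha.symm
      by_contra hne
      refine h a ?_ hz'
      rintro rfl
      exact hne (by rw [← hz', AddChar.map_zero_eq_one])
  rw [h]
  exact (Set.toFinite _).isClosed.isOpen_compl

/-- By continuity some `𝔊_n` is mapped near `1`, hence to `1`. Every character thus has only
finitely many nonzero digits at positive places. -/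
lemma exists_mem_annih (χ : CharGroup p) : ∃ n : ℤ, χ ∈ annih p n := by
  have hc : Continuous fun x : VilenkinGroup p => χ (Multiplicative.ofAdd x) :=
    (map_continuous χ).comp continuous_ofAdd
  have hmem := (isOpen_rootsOfUnity_compl (p := p)).preimage hc |>.mem_nhds
    (x := (0 : VilenkinGroup p)) (fun _ => by simp)
  obtain ⟨n, -, hn⟩ := hasBasis_zero.mem_iff.1 hmem
  refine ⟨n, fun x hx => ?_⟩
  have := hn hx (pair_pow_char χ x)
  exact congrArg (fun z : Circle => (z : ℂ)) this

/-- Modulo `𝔊_n`, which `χ` kills, `x` is a finite combination of `g_m, …, g_{n-1}`. -/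
lemma pair_eq_sum {m n : ℤ} {χ : CharGroup p} (hχ : χ ∈ annih p n) {x : VilenkinGroup p}
    (hx : x ∈ Gsub p m) :
    pair χ x = ZMod.toCircle (∑ k ∈ Finset.Ico m n, coord k x * dig k χ) := by
  set y := ∑ k ∈ Finset.Ico m n, (coord k x).val • g p k with hy
  have hxy : x - y ∈ Gsub p n := by
    intro k hk
    have : coord k y = if k ∈ Finset.Ico m n then coord k x else 0 := by
      rw [hy, coord_sum]
      simp_rw [map_nsmul, coord_g, nsmul_eq_mul, ZMod.natCast_zmod_val, mul_ite, mul_one, mul_zero]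
      rw [Finset.sum_ite_eq]
    rw [map_sub, this]
    split_ifs with h
    · exact sub_self _
    · rw [Finset.mem_Ico] at h
      rw [hx k (by omega), sub_zero]
  have h1 : pair χ x = pair χ y := by
    rw [← sub_add_cancel x y, pair_add, hχ _ hxy, one_mul]
  rw [h1, hy, pair_sum, toCircle_sum]
  refine Finset.prod_congr rfl fun k _ => ?_
  rw [pair_nsmul, pair_g, ← Circle.coe_pow, ← AddChar.map_nsmul_eq_pow, nsmul_eq_mul,
    ZMod.natCast_zmod_val]

lemma mem_annih_iff {n : ℤ} {χ : CharGroup p} : χ ∈ annih p n ↔ ∀ k ≥ n, dig k χ = 0 := by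
  constructor
  · intro h k hk
    rw [dig_eq_iff, h _ (fun j hj => by rw [coord_g, if_neg (by omega)])]
    simp
  · intro h x hx
    obtain ⟨m, hm⟩ := exists_mem_annih χ
    rw [pair_eq_sum hm hx, Finset.sum_eq_zero, AddChar.map_zero_eq_one, Circle.coe_one]
    intro k hk
    rw [h k (Finset.mem_Ico.1 hk).1, mul_zero]

lemma annih_mono {m n : ℤ} (h : m ≤ n) : annih p m ⊆ annih p n := fun _ hχ =>
  mem_annih_iff.2 fun k hk => mem_annih_iff.1 hχ k (h.trans hk)

lemma charDilation_mem_annih {m n : ℤ} {χ : CharGroup p} :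
    charDilation n χ ∈ annih p m ↔ χ ∈ annih p (m - n) := by
  simp_rw [mem_annih_iff, dig_charDilation]
  exact ⟨fun h k hk => by simpa using h (k + n) (by omega), fun h k hk => h _ (by omega)⟩

end Vilenkin

/-! ### Annihilators, Haar measures and orthogonality of characters. -/

namespace Vilenkin

variable {p : ℕ} [Fact p.Prime]

/-- The annihilator `𝔊_n^⊥` as a subgroup. -/
def annihSubgroup (p : ℕ) [Fact p.Prime] (n : ℤ) : Subgroup (CharGroup p) where
  carrier := annih p n
  one_mem' := fun x _ => pair_one x
  mul_mem' := fun {χ χ'} h h' x hx => by rw [pair_mul, h x hx, h' x hx, one_mul]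
  inv_mem' := fun {χ} h x hx => by rw [pair_inv, h x hx, map_one]

lemma mul_mem_annih {n : ℤ} {χ ζ : CharGroup p} (hζ : ζ ∈ annih p n) :
    ζ * χ ∈ annih p n ↔ χ ∈ annih p n :=
  (annihSubgroup p n).mul_mem_cancel_left hζ

lemma isCompact_Gsub (n : ℤ) : IsCompact (Gsub p n : Set (VilenkinGroup p)) := by
  have h : (Gsub p n : Set (VilenkinGroup p)) = dilation p (-n) '' Gsub p 0 := by
    ext x
    constructor
    · intro hx
      refine ⟨dilation p n x, fun k hk => ?_, ?_⟩
      · rw [coord_dilation]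
        exact hx _ (by omega)
      · rw [← dilation_add, neg_add_cancel, dilation_zero]
    · rintro ⟨y, hy, rfl⟩ k hk
      rw [coord_dilation]
      exact hy _ (by omega)
  rw [h]
  exact isCompact_Gsub_zero.image (dilation p (-n)).continuous_toFun

/-- For the compact set `𝔊_n`, being trivial on it is the same as mapping it into the open set of
`isOpen_rootsOfUnity_compl`, a compact-open condition. -/
lemma isOpen_annih (n : ℤ) : IsOpen (annih p n) := by
  have hK : IsCompact (Multiplicative.ofAdd '' (Gsub p n : Set (VilenkinGroup p))) :=
    (isCompact_Gsub n).image continuous_ofAdd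
  have h := (ContinuousMap.isOpen_setOfPred_mapsTo hK
    (isOpen_rootsOfUnity_compl (p := p))).preimage isInducing_toContinuousMap.continuous
  convert h using 1
  ext χ
  constructor
  · rintro hχ _ ⟨x, hx, rfl⟩ -
    exact Circle.ext (hχ x hx)
  · intro hχ x hx
    exact congrArg (fun z : Circle => (z : ℂ)) (hχ ⟨x, hx, rfl⟩ (pair_pow_char χ x))

/-- A compact set of `𝔊` lies in one `𝔊_n`, so all characters of `𝔊_n^⊥` are `1` on it. -/
lemma exists_annih_subset {S : Set (CharGroup p)} (hS : S ∈ nhds (1 : CharGroup p)) :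
    ∃ n : ℤ, annih p n ⊆ S := by
  have hdir : Directed (· ≥ ·) fun n : ℤ => annih p n := fun m n =>
    ⟨min m n, annih_mono (min_le_left _ _), annih_mono (min_le_right _ _)⟩
  have hb := Filter.hasBasis_iInf_principal hdir
  have ht : Filter.Tendsto (fun χ : CharGroup p => χ) (⨅ n : ℤ, Filter.principal (annih p n))
      (nhds 1) := by
    rw [isInducing_toContinuousMap.tendsto_nhds_iff, ContinuousMap.tendsto_nhds_compactOpen]
    intro K hK U _ hKU
    obtain ⟨n, hn⟩ := (hK.image continuous_toAdd).elim_directed_cover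
      (fun n : ℤ => (Gsub p n : Set (VilenkinGroup p))) (fun n => isOpen_Gsub n)
      (fun x _ => Set.mem_iUnion.2 (exists_mem_Gsub x))
      (fun m n => ⟨min m n, Gsub_anti (min_le_left _ _), Gsub_anti (min_le_right _ _)⟩)
    refine hb.eventually_iff.2 ⟨n, trivial, fun χ hχ x hx => ?_⟩
    have h1 : χ x = 1 := Circle.ext (hχ _ (hn ⟨x, hx, rfl⟩))
    change χ x ∈ U
    rw [h1]
    exact hKU hx
  obtain ⟨n, -, hn⟩ := hb.mem_iff.1 (ht hS)
  exact ⟨n, hn⟩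

lemma measurableSet_annih (n : ℤ) : MeasurableSet (annih p n) := (isOpen_annih n).measurableSet

/-- Sorting by the digit at place `n` splits the larger annihilator into `p` translates of the
smaller one. -/
lemma measure_annih_succ (ρ : Measure (CharGroup p)) [ρ.IsMulLeftInvariant] (n : ℤ) :
    ρ (annih p (n + 1)) = p * ρ (annih p n) := by
  have h : annih p (n + 1) = ⋃ a : ZMod p, (fun χ => r p n ^ a.val * χ) ⁻¹' annih p n := by
    ext χ
    simp only [Set.mem_iUnion, Set.mem_preimage, mem_annih_iff, dig_mul, dig_pow, dig_r,
      ZMod.natCast_zmod_val]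
    constructor
    · intro hχ
      refine ⟨-dig n χ, fun k hk => ?_⟩
      rcases eq_or_lt_of_le hk with rfl | hlt
      · simp
      · rw [hχ k (by omega), if_neg (by omega)]
        simp
    · rintro ⟨a, ha⟩ k hk
      simpa [show k ≠ n by omega] using ha k (by omega)
  rw [h, measure_iUnion, tsum_fintype]
  · simp_rw [measure_preimage_mul]
    rw [Finset.sum_const, Finset.card_univ, ZMod.card, nsmul_eq_mul]
  · intro a b hab
    refine Set.disjoint_left.2 fun χ ha hb => hab ?_
    have ha' := mem_annih_iff.1 ha n le_rfl
    have hb' := mem_annih_iff.1 hb n le_rfl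
    simp only [dig_mul, dig_pow, dig_r, ZMod.natCast_zmod_val, if_true, mul_one] at ha' hb'
    exact add_right_cancel (ha'.trans hb'.symm)
  · exact fun a => measurable_const_mul _ (measurableSet_annih n)

lemma measure_Gsub_succ (ρ : Measure (VilenkinGroup p)) [ρ.IsAddLeftInvariant] (n : ℤ) :
    ρ (Gsub p n) = p * ρ (Gsub p (n + 1)) := by
  have h : (Gsub p n : Set (VilenkinGroup p))
      = ⋃ a : ZMod p, (fun x => a.val • g p n + x) ⁻¹' (Gsub p (n + 1) : Set _) := by
    ext x
    simp only [Set.mem_iUnion, Set.mem_preimage, SetLike.mem_coe, mem_Gsub, map_add, map_nsmul,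
      coord_g, nsmul_eq_mul, ZMod.natCast_zmod_val]
    constructor
    · intro hx
      refine ⟨-coord n x, fun k hk => ?_⟩
      rcases eq_or_ne k n with rfl | hne
      · simp
      · rw [hx k (by omega), if_neg hne]
        simp
    · rintro ⟨a, ha⟩ k hk
      simpa [show k ≠ n by omega] using ha k (by omega)
  rw [h, measure_iUnion, tsum_fintype]
  · simp_rw [measure_preimage_add]
    rw [Finset.sum_const, Finset.card_univ, ZMod.card, nsmul_eq_mul]
  · intro a b hab
    refine Set.disjoint_left.2 fun x ha hb => hab ?_
    have ha' := mem_Gsub.1 ha n (by omega)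
    have hb' := mem_Gsub.1 hb n (by omega)
    simp only [map_add, map_nsmul, coord_g, nsmul_eq_mul, ZMod.natCast_zmod_val, if_true,
      mul_one] at ha' hb'
    exact add_right_cancel (ha'.trans hb'.symm)
  · exact fun a => measurable_const_add _ (measurableSet_Gsub _)

/-- Needed for the normalisation of `haarX` to be meaningful. A small annihilator has finite
measure, and each enlargement multiplies the measure by `p`. -/
lemma haar_annih_zero_ne_top : (Measure.haar : Measure (CharGroup p)) (annih p 0) ≠ ⊤ := by
  obtain ⟨S, hS, hfin⟩ := (Measure.haar : Measure (CharGroup p)).exists_isOpen_measure_lt_top 1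
  obtain ⟨n, hn⟩ := exists_annih_subset (hfin.1.mem_nhds hS)
  have key : ∀ k : ℕ, (Measure.haar : Measure (CharGroup p)) (annih p (n + k)) ≠ ⊤ := by
    intro k
    induction k with
    | zero => simpa using ne_top_of_le_ne_top hfin.2.ne (measure_mono hn)
    | succ k ih =>
      rw [Nat.cast_succ, ← add_assoc, measure_annih_succ]
      exact ENNReal.mul_ne_top (ENNReal.natCast_ne_top p) ih
  exact ne_top_of_le_ne_top (key n.natAbs) (measure_mono (annih_mono (by omega)))

instance : (haarX p).IsMulLeftInvariant := by unfold haarX; infer_instance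

instance : (haarG p).IsAddLeftInvariant := by unfold haarG; infer_instance

lemma haarX_annih_zero : haarX p (annih p 0) = 1 := by
  rw [haarX, Measure.smul_apply, smul_eq_mul]
  refine ENNReal.inv_mul_cancel ?_ haar_annih_zero_ne_top
  exact ((isOpen_annih 0).measure_pos _ ⟨1, (annihSubgroup p 0).one_mem⟩).ne'

lemma haarG_Gsub_zero : haarG p (Gsub p 0) = 1 := Measure.addHaarMeasure_self

lemma zpow_eq_of_succ {u : ℤ → ENNReal} (h0 : u 0 = 1) (hs : ∀ n, u (n + 1) = p * u n) (n : ℤ) :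
    u n = ENNReal.ofReal ((p : ℝ) ^ n) := by
  have hp : (0 : ℝ) < p := by exact_mod_cast (Fact.out : p.Prime).pos
  induction n using Int.induction_on with
  | zero => simp [h0]
  | succ k ih =>
    rw [hs, ih, zpow_add_one₀ hp.ne', mul_comm, ENNReal.ofReal_mul (by positivity),
      ENNReal.ofReal_natCast]
  | pred k ih =>
    have h := hs (-(k : ℤ) - 1)
    rw [sub_add_cancel, ih, ← sub_add_cancel (-(k : ℤ)) 1, zpow_add_one₀ hp.ne', mul_comm,
      ENNReal.ofReal_mul hp.le, ENNReal.ofReal_natCast] at h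
    rw [add_sub_cancel_right] at h
    exact ((ENNReal.mul_right_inj (by simpa using hp.ne') (ENNReal.natCast_ne_top p)).1 h).symm

lemma haarX_annih (n : ℤ) : haarX p (annih p n) = ENNReal.ofReal ((p : ℝ) ^ n) :=
  zpow_eq_of_succ (u := fun n => haarX p (annih p n)) haarX_annih_zero
    (fun n => measure_annih_succ _ n) n

lemma haarG_Gsub (n : ℤ) : haarG p (Gsub p n) = ENNReal.ofReal ((p : ℝ) ^ (-n)) := by
  have h := zpow_eq_of_succ (p := p) (u := fun n => haarG p (Gsub p (-n))) haarG_Gsub_zero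
    (fun n => by
      have := measure_Gsub_succ (haarG p) (-(n + 1))
      rwa [show -(n + 1) + 1 = -n by ring] at this) (-n)
  simpa using h

lemma setIntegral_Gsub_pair (n : ℤ) (χ : CharGroup p) [Decidable (χ ∈ annih p n)] :
    ∫ x in Gsub p n, pair χ x ∂(haarG p) = if χ ∈ annih p n then (p : ℂ) ^ (-n) else 0 := by
  split_ifs with h
  · rw [setIntegral_congr_fun (measurableSet_Gsub n) h, setIntegral_const, measureReal_def,
      haarG_Gsub, ENNReal.toReal_ofReal (by positivity)]
    simp
  · simp only [annih, Set.mem_ofPred_eq, not_forall] at h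
    obtain ⟨y, hy, hne⟩ := h
    -- Translating by `y` multiplies the integral by `(χ, y) ≠ 1` without changing it, so it is
    -- zero.
    have hi := integral_add_left_eq_self (μ := haarG p)
      ((Gsub p n : Set (VilenkinGroup p)).indicator (pair χ)) y
    have h1 : (fun x => (Gsub p n : Set (VilenkinGroup p)).indicator (pair χ) (y + x))
        = fun x => pair χ y * (Gsub p n : Set (VilenkinGroup p)).indicator (pair χ) x := by
      funext x
      by_cases hx : x ∈ Gsub p n
      · rw [Set.indicator_of_mem (show y + x ∈ _ from add_mem hy hx), Set.indicator_of_mem hx,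
          pair_add]
      · rw [Set.indicator_of_notMem (show y + x ∉ (Gsub p n : Set _) from fun h =>
          hx (((Gsub p n).add_mem_cancel_left hy).1 h)), Set.indicator_of_notMem hx, mul_zero]
    rw [h1, integral_const_mul, integral_indicator (measurableSet_Gsub n)] at hi
    exact (mul_left_eq_self₀.1 hi).resolve_left hne

lemma setIntegral_annih_pair (n : ℤ) (x : VilenkinGroup p) [Decidable (x ∈ Gsub p n)] :
    ∫ χ in annih p n, pair χ x ∂(haarX p) = if x ∈ Gsub p n then (p : ℂ) ^ n else 0 := by
  split_ifs with h
  · rw [setIntegral_congr_fun (measurableSet_annih n) (fun χ hχ => hχ x h), setIntegral_const,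
      measureReal_def, haarX_annih, ENNReal.toReal_ofReal (by positivity)]
    simp
  · simp only [mem_Gsub, not_forall] at h
    obtain ⟨k, hk, hne⟩ := h
    have hr : r p k ∈ annih p n := mem_annih_iff.2 fun j hj => by
      rw [dig_r, if_neg (by omega)]
    have hne' : pair (r p k) x ≠ 1 := by
      rw [pair_r]
      intro h1
      refine hne (toCircle_coe_injective ?_)
      simpa using h1
    have hi := integral_mul_left_eq_self (μ := haarX p)
      ((annih p n).indicator fun χ => pair χ x) (r p k)
    have h1 : (fun χ => (annih p n).indicator (fun χ => pair χ x) (r p k * χ))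
        = fun χ => pair (r p k) x * (annih p n).indicator (fun χ => pair χ x) χ := by
      funext χ
      by_cases hχ : χ ∈ annih p n
      · rw [Set.indicator_of_mem ((mul_mem_annih hr).2 hχ), Set.indicator_of_mem hχ, pair_mul]
      · rw [Set.indicator_of_notMem (fun h => hχ ((mul_mem_annih hr).1 h)),
          Set.indicator_of_notMem hχ, mul_zero]
    rw [h1, integral_const_mul, integral_indicator (measurableSet_annih n)] at hi
    exact (mul_left_eq_self₀.1 hi).resolve_left hne'

end Vilenkin

/-! ### Step functions on the character group and Parseval's identity. -/

namespace Vilenkin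

variable {p : ℕ} [Fact p.Prime]

/-- `f` is constant on the cosets of `𝔊_M^⊥` and supported on the disjoint union of the cosets
`σ i 𝔊_M^⊥`. -/
structure IsStep {ι : Type*} (M : ℤ) (f : CharGroup p → ℂ) (σ : ι → CharGroup p) : Prop where
  const : ∀ χ, ∀ ζ ∈ annih p M, f (ζ * χ) = f χ
  supp : ∀ χ, f χ ≠ 0 → ∃ i, (σ i)⁻¹ * χ ∈ annih p M
  inj : ∀ i j, (σ i)⁻¹ * σ j ∈ annih p M → i = j

/-- The function `p^M 1_{𝔊_M} ∑ c_i σ_i`. -/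
def stepFun {ι : Type*} [Fintype ι] (M : ℤ) (c : ι → ℂ) (σ : ι → CharGroup p) :
    VilenkinGroup p → ℂ :=
  (Gsub p M : Set (VilenkinGroup p)).indicator fun x => (p : ℂ) ^ M * ∑ i, c i * pair (σ i) x

section

variable {ι : Type*} [Fintype ι] {M : ℤ} {f : CharGroup p → ℂ} {σ : ι → CharGroup p}

/-- At most one summand is nonzero. Every summand is a multiple of a translate of one fixed
function, so invariance of `haarX` evaluates all the integrals at once. -/
lemma IsStep.eq_sum (h : IsStep M f σ) (x : VilenkinGroup p) (χ : CharGroup p) :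
    f χ * pair χ x = ∑ i, f (σ i) * (pair (σ i) x *
      (annih p M).indicator (fun χ => pair χ x) ((σ i)⁻¹ * χ)) := by
  classical
  by_cases hχ : ∃ i, (σ i)⁻¹ * χ ∈ annih p M
  · obtain ⟨i, hi⟩ := hχ
    rw [Finset.sum_eq_single i]
    · rw [Set.indicator_of_mem hi, ← pair_mul, mul_inv_cancel_left, ← h.const (σ i) _ hi]
      congr 2
      rw [mul_comm, mul_inv_cancel_left]
    · intro j _ hj
      rw [Set.indicator_of_notMem, mul_zero, mul_zero]
      intro hj'
      refine hj (h.inj _ _ ?_)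
      have := (annihSubgroup p M).mul_mem hj' ((annihSubgroup p M).inv_mem hi)
      rwa [show (σ j)⁻¹ * χ * ((σ i)⁻¹ * χ)⁻¹ = (σ j)⁻¹ * σ i by
        rw [mul_inv_rev, inv_inv, mul_assoc, mul_inv_cancel_left]] at this
    · simp
  · have hz : f χ = 0 := by
      by_contra hne
      exact hχ (h.supp χ hne)
    rw [hz, zero_mul, Finset.sum_eq_zero]
    intro i _
    rw [Set.indicator_of_notMem (fun hi => hχ ⟨i, hi⟩), mul_zero, mul_zero]

lemma integrable_indicator_annih (M : ℤ) (x : VilenkinGroup p) :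
    Integrable ((annih p M).indicator fun χ => pair χ x) (haarX p) := by
  rw [integrable_indicator_iff (measurableSet_annih M)]
  refine Measure.integrableOn_of_bounded (M := 1) ?_
    (continuous_pair_left x).aestronglyMeasurable (.of_forall fun χ => (norm_pair χ x).le)
  rw [haarX_annih]
  exact ENNReal.ofReal_ne_top

lemma IsStep.integrable (h : IsStep M f σ) (x : VilenkinGroup p) :
    Integrable (fun χ => f χ * pair χ x) (haarX p) := by
  simp_rw [h.eq_sum x]
  exact integrable_finsetSum _ fun i _ =>
    (((integrable_indicator_annih M x).comp_mul_left (σ i)⁻¹).const_mul _).const_mul _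

lemma IsStep.integral (h : IsStep M f σ) (x : VilenkinGroup p) :
    ∫ χ, f χ * pair χ x ∂(haarX p) = stepFun M (fun i => f (σ i)) σ x := by
  classical
  simp_rw [h.eq_sum x]
  rw [integral_finsetSum _ fun i _ =>
    (((integrable_indicator_annih M x).comp_mul_left (σ i)⁻¹).const_mul _).const_mul _]
  simp_rw [integral_const_mul]
  have h1 : ∀ i, ∫ χ, (annih p M).indicator (fun χ => pair χ x) ((σ i)⁻¹ * χ) ∂(haarX p)
      = if x ∈ Gsub p M then (p : ℂ) ^ M else 0 := fun i => by
    rw [integral_mul_left_eq_self (μ := haarX p) ((annih p M).indicator fun χ => pair χ x),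
      integral_indicator (measurableSet_annih M), setIntegral_annih_pair]
  simp_rw [h1, stepFun, Set.indicator_apply, SetLike.mem_coe]
  split_ifs
  · rw [Finset.mul_sum]
    exact Finset.sum_congr rfl fun i _ => by ring
  · simp

lemma memLp_stepFun (M : ℤ) (c : ι → ℂ) (σ : ι → CharGroup p) :
    MemLp (stepFun M c σ) 2 (haarG p) := by
  rw [stepFun, memLp_indicator_iff_restrict (measurableSet_Gsub M)]
  have : IsFiniteMeasure ((haarG p).restrict (Gsub p M : Set (VilenkinGroup p))) :=
    isFiniteMeasure_restrict.2 (by rw [haarG_Gsub]; exact ENNReal.ofReal_ne_top)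
  have hc : Continuous fun x => (p : ℂ) ^ M * ∑ i, c i * pair (σ i) x :=
    continuous_const.mul (continuous_finsetSum _ fun i _ =>
      continuous_const.mul (continuous_pair_right _))
  refine MemLp.of_bound hc.aestronglyMeasurable (‖(p : ℂ) ^ M‖ * ∑ i, ‖c i‖)
    (.of_forall fun x => ?_)
  rw [norm_mul]
  gcongr
  refine (norm_sum_le _ _).trans (Finset.sum_le_sum fun i _ => ?_)
  rw [norm_mul, norm_pair, mul_one]

lemma memLp_comp_sub {F : VilenkinGroup p → ℂ} (hF : MemLp F 2 (haarG p)) (h : VilenkinGroup p) :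
    MemLp (fun x => F (x - h)) 2 (haarG p) :=
  hF.comp_measurePreserving (measurePreserving_sub_right (haarG p) h)

omit [Fact p.Prime] in
-- A shift inside `𝔊_M` keeps the support and only modulates the coefficients, so Parseval also
-- covers translates.
lemma stepFun_add_of_mem {t : VilenkinGroup p} (ht : t ∈ Gsub p M) (c : ι → ℂ)
    (σ : ι → CharGroup p) (x : VilenkinGroup p) :
    stepFun M c σ (x + t) = stepFun M (fun i => c i * pair (σ i) t) σ x := by
  classical
  simp_rw [stepFun, Set.indicator_apply, SetLike.mem_coe, (Gsub p M).add_mem_cancel_right ht,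
    pair_add]
  congr 3
  funext i
  ring

end

/-- Parseval's identity for the functions `stepFun`. -/
lemma integral_conj_stepFun_mul_stepFun {ι κ : Type*} [Fintype ι] [Fintype κ] (M : ℤ)
    (c : ι → ℂ) (σ : ι → CharGroup p) (d : κ → ℂ) (τ : κ → CharGroup p)
    [∀ i j, Decidable ((σ i)⁻¹ * τ j ∈ annih p M)] :
    ∫ x, (starRingEnd ℂ) (stepFun M c σ x) * stepFun M d τ x ∂(haarG p)
      = (p : ℂ) ^ M * ∑ i, ∑ j,
        if (σ i)⁻¹ * τ j ∈ annih p M then (starRingEnd ℂ) (c i) * d j else 0 := by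
  have hp : (p : ℂ) ≠ 0 := by exact_mod_cast (Fact.out : p.Prime).ne_zero
  have h1 : (fun x => (starRingEnd ℂ) (stepFun M c σ x) * stepFun M d τ x)
      = (Gsub p M : Set (VilenkinGroup p)).indicator fun x => ∑ i, ∑ j,
        ((p : ℂ) ^ M * (p : ℂ) ^ M * ((starRingEnd ℂ) (c i) * d j)) *
          pair ((σ i)⁻¹ * τ j) x := by
    funext x
    by_cases hx : x ∈ (Gsub p M : Set (VilenkinGroup p))
    · rw [stepFun, stepFun, Set.indicator_of_mem hx, Set.indicator_of_mem hx,
        Set.indicator_of_mem hx, map_mul, map_sum, map_zpow₀, map_natCast,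
        mul_mul_mul_comm, Finset.sum_mul_sum, Finset.mul_sum]
      refine Finset.sum_congr rfl fun i _ => ?_
      rw [Finset.mul_sum]
      refine Finset.sum_congr rfl fun j _ => ?_
      rw [map_mul, pair_mul, pair_inv]
      ring
    · rw [stepFun, Set.indicator_of_notMem hx, Set.indicator_of_notMem hx, map_zero, zero_mul]
  have hint : ∀ (a : ℂ) (χ : CharGroup p), Integrable (fun x => a * pair χ x)
      ((haarG p).restrict (Gsub p M : Set (VilenkinGroup p))) := fun a χ => by
    refine Integrable.const_mul (Measure.integrableOn_of_bounded (M := 1) ?_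
      (continuous_pair_right χ).aestronglyMeasurable (.of_forall fun x => (norm_pair χ x).le)) a
    rw [haarG_Gsub]
    exact ENNReal.ofReal_ne_top
  rw [h1, integral_indicator (measurableSet_Gsub M),
    integral_finsetSum _ fun i _ => integrable_finsetSum _ fun j _ => hint _ _, Finset.mul_sum]
  refine Finset.sum_congr rfl fun i _ => ?_
  rw [integral_finsetSum _ fun j _ => hint _ _, Finset.mul_sum]
  refine Finset.sum_congr rfl fun j _ => ?_
  rw [integral_const_mul, setIntegral_Gsub_pair]
  split_ifs
  · rw [zpow_neg]
    field_simp
  · simp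

end Vilenkin

/-! ### Combinatorics of `N`-valid trees. -/

namespace Vilenkin

section Tree

variable {p : ℕ} {T : RootedTree} {label : T → ZMod p} {N : ℕ}

lemma pred_covBy {x : T} (hx : x ≠ ⊥) : Order.pred x ⋖ x :=
  Order.pred_covBy_of_not_isMin fun h => hx h.eq_bot

lemma exists_pred_iterate_eq_bot (x : T) : ∃ n : ℕ, Order.pred^[n] x = ⊥ :=
  exists_pred_iterate_of_le bot_le

lemma pred_iterate_eq_bot {x : T} {m n : ℕ} (hx : Order.pred^[m] x = ⊥) (h : m ≤ n) :
    Order.pred^[n] x = ⊥ := by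
  obtain ⟨k, rfl⟩ := Nat.exists_eq_add_of_le h
  rw [add_comm, Function.iterate_add_apply, hx]
  exact Function.iterate_fixed Order.pred_bot k

lemma height_le_of_pred_iterate (n : ℕ) (x : T) (hx : Order.pred^[n] x = ⊥) :
    Order.height x ≤ (n : ℕ∞) := by
  induction n generalizing x with
  | zero =>
    rw [Function.iterate_zero_apply] at hx
    simp [hx]
  | succ n ih =>
    rw [Order.height_le_coe_iff]
    intro y hy
    refine lt_of_le_of_lt ((Order.height_mono (Order.le_pred_of_lt hy)).trans
      (ih (Order.pred x) (by rwa [Function.iterate_succ_apply] at hx))) ?_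
    exact_mod_cast n.lt_succ_self

lemma IsPath.pred_iterate_eq {n : ℕ} {v : Fin n → T} (hv : IsPath v) (i : ℕ) (j k : Fin n)
    (h : (j : ℕ) + i = k) : Order.pred^[i] (v k) = v j := by
  induction i generalizing k with
  | zero =>
    rw [Function.iterate_zero_apply]
    congr 1
    exact (Fin.ext h).symm
  | succ i ih =>
    have hk : (j : ℕ) + i < n := by omega
    rw [Function.iterate_succ_apply, (hv ⟨j + i, hk⟩ k h).pred_eq]
    exact ih ⟨j + i, hk⟩ rfl

namespace IsNValid

variable (hT : IsNValid T label N)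
include hT

/-- The unique path along which a word of `N` labels is read. -/
def path (w : Fin N → ZMod p) : Fin N → T := (hT.existsUnique_path w).choose

lemma isPath_path (w : Fin N → ZMod p) : IsPath (hT.path w) :=
  (hT.existsUnique_path w).choose_spec.1.1

lemma label_path (w : Fin N → ZMod p) (i : Fin N) : label (hT.path w i) = w i :=
  (hT.existsUnique_path w).choose_spec.1.2 i

lemma eq_path {w : Fin N → ZMod p} {v : Fin N → T} (hv : IsPath v) (h : ∀ i, label (v i) = w i) :
    v = hT.path w :=
  (hT.existsUnique_path w).choose_spec.2 v ⟨hv, h⟩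

variable [NeZero N]

/-- The first vertex of the path along which a word is read. -/
def top (w : Fin N → ZMod p) : T := hT.path w 0

lemma label_bot : label (⊥ : T) = 0 := by
  refine hT.label_eq_zero _ ?_
  rw [Order.height_bot]
  exact_mod_cast NeZero.pos N

/-- A path of `N` vertices starting at the root stays in levels below `N`, where all labels are
zero. -/
lemma eq_zero_of_top_eq_bot {w : Fin N → ZMod p} (h : hT.top w = ⊥) : w = 0 := by
  funext i
  rw [← hT.label_path w i]
  refine hT.label_eq_zero _ (lt_of_le_of_lt (height_le_of_pred_iterate i _ ?_)
    (by exact_mod_cast i.2))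
  rw [(hT.isPath_path w).pred_iterate_eq i 0 i (by simp)]
  exact h

/-- The branch from the root to the last vertex of the zero path has at least `N` vertices. Its
first `N` vertices read the zero word, so by uniqueness they are the zero path. -/
lemma top_zero : hT.top 0 = ⊥ := by
  classical
  have hN := NeZero.pos N
  set v := hT.path 0 with hv
  let e : Fin N := ⟨N - 1, by omega⟩
  have hex := exists_pred_iterate_eq_bot (v e)
  set k := Nat.find hex with hk
  have hbot : Order.pred^[k] (v e) = ⊥ := Nat.find_spec hex
  have hNk : N - 1 ≤ k := by
    by_contra hlt
    push Not at hlt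
    have h1 := (hT.isPath_path 0).pred_iterate_eq k ⟨N - 1 - k, by omega⟩ e
      (by change N - 1 - k + k = N - 1; omega)
    have h2 := (hT.isPath_path 0) ⟨N - 1 - k - 1, by omega⟩ ⟨N - 1 - k, by omega⟩
      (by change N - 1 - k - 1 + 1 = N - 1 - k; omega)
    rw [← h1, ← hv, hbot] at h2
    exact not_lt_bot h2.lt
  have huniq : (fun j : Fin N => Order.pred^[k - j] (v e)) = v := by
    refine hT.eq_path ?_ ?_
    · intro i j hij
      have hi : k - (i : ℕ) = (k - j) + 1 := by omega
      change Order.pred^[k - i] (v e) ⋖ Order.pred^[k - j] (v e)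
      rw [hi, Function.iterate_succ_apply']
      exact pred_covBy (Nat.find_min hex (by omega))
    · intro i
      refine hT.label_eq_zero _ (lt_of_le_of_lt (height_le_of_pred_iterate i _ ?_)
        (by exact_mod_cast i.2))
      rw [← Function.iterate_add_apply, show (i : ℕ) + (k - i) = k by omega, hbot]
  have := congrFun huniq 0
  rw [top, ← hv, ← this]
  simpa using hbot

/-- The words of `N + 1` labels that are zero or read along a path. -/
lemma isPath_iff (α : Fin (N + 1) → ZMod p) :
    (α = 0 ∨ ∃ v : Fin (N + 1) → T, IsPath v ∧ ∀ j, label (v j) = α j)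
      ↔ α 0 = label (Order.pred (hT.top (Fin.tail α))) := by
  constructor
  · rintro (rfl | ⟨v, hv, hl⟩)
    · rw [show Fin.tail (0 : Fin (N + 1) → ZMod p) = 0 from rfl, hT.top_zero, Order.pred_bot,
        hT.label_bot]
      rfl
    · have h1 : Fin.tail v = hT.path (Fin.tail α) :=
        hT.eq_path (fun i j hij => hv _ _ (by simpa using hij)) fun i => hl i.succ
      have h2 : v 0 ⋖ hT.top (Fin.tail α) := by
        rw [top, ← h1]
        exact hv 0 (Fin.succ 0) (by simp only [Fin.val_succ, Fin.coe_ofNat_eq_mod, Nat.zero_mod])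
      rw [h2.pred_eq, hl]
  · intro h
    -- Above the root there is nothing to prepend. `Order.pred` fixes `⊥`, whose label is zero, so
    -- this case yields the zero word, which accounts for `𝔊_{-N}^⊥` in `Ẽ`.
    by_cases hb : hT.top (Fin.tail α) = ⊥
    · left
      rw [hb, Order.pred_bot, hT.label_bot] at h
      have h0 := hT.eq_zero_of_top_eq_bot hb
      funext i
      refine Fin.cases h (fun j => congrFun h0 j) i
    · right
      refine ⟨Fin.cons (Order.pred (hT.top (Fin.tail α))) (hT.path (Fin.tail α)), ?_, ?_⟩
      · intro i j hij
        obtain ⟨j, rfl⟩ := Fin.exists_succ_eq.2 (show j ≠ 0 by rintro rfl; simp at hij)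
        rw [Fin.cons_succ]
        refine Fin.cases (fun hij => ?_) (fun i hij => ?_) i hij
        · have : j = 0 := Fin.ext (by simpa using hij.symm)
          rw [Fin.cons_zero, this]
          exact pred_covBy hb
        · rw [Fin.cons_succ]
          exact hT.isPath_path _ i j (by simpa using hij)
      · refine Fin.cases ?_ fun j => ?_
        · rw [Fin.cons_zero, h]
        · rw [Fin.cons_succ, hT.label_path]
          rfl

/-- Sliding the window of `N` labels by one place towards the root moves its top vertex to the
parent. -/
lemma top_init {α : Fin (N + 1) → ZMod p}
    (h : α 0 = label (Order.pred (hT.top (Fin.tail α)))) :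
    hT.top (Fin.init α) = Order.pred (hT.top (Fin.tail α)) := by
  rcases (hT.isPath_iff α).2 h with rfl | ⟨v, hv, hl⟩
  · rw [show Fin.tail (0 : Fin (N + 1) → ZMod p) = 0 from rfl,
      show Fin.init (0 : Fin (N + 1) → ZMod p) = 0 from rfl, hT.top_zero, Order.pred_bot]
  · have h1 : Fin.tail v = hT.path (Fin.tail α) :=
      hT.eq_path (fun i j hij => hv _ _ (by simpa using hij)) fun i => hl i.succ
    have h2 : Fin.init v = hT.path (Fin.init α) :=
      hT.eq_path (fun i j hij => hv _ _ (by simpa using hij)) fun i => hl i.castSucc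
    have h3 : v 0 ⋖ hT.top (Fin.tail α) := by
      rw [top, ← h1]
      exact hv 0 (Fin.succ 0) (by simp only [Fin.val_succ, Fin.coe_ofNat_eq_mod, Nat.zero_mod])
    rw [h3.pred_eq, top, ← h2]
    rfl

/-- The labels met on the way from the path of a word to the root. -/
def ext (w : Fin N → ZMod p) (n : ℕ) : ZMod p := label (Order.pred^[n + 1] (hT.top w))

/-- There are finitely many words, so the climbs to the root have bounded length; past the root the
labels read are zero. -/
lemma exists_ext_eq_zero [Fact p.Prime] : ∃ K : ℕ, ∀ w n, K ≤ n → hT.ext w n = 0 := by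
  choose k hk using fun w => exists_pred_iterate_eq_bot (hT.top w)
  refine ⟨Finset.univ.sup k, fun w n hn => ?_⟩
  have hkn : k w ≤ n := (Finset.le_sup (Finset.mem_univ w)).trans hn
  rw [ext, pred_iterate_eq_bot (hk w) (by omega), hT.label_bot]

/-- A sequence all of whose words are zero or read along paths is determined by `ext`. -/
lemma forall_eq_label_iff (a : ℤ → ZMod p) :
    (∀ n : ℕ, a n = label (Order.pred (hT.top fun i : Fin N => a ((n : ℤ) - 1 - i)))) ↔
      ∀ n : ℕ, a n = hT.ext (fun i : Fin N => a (-1 - i)) n := by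
  -- The hypothesis concerns only places below `n`, so the claim also serves inside the strong
  -- induction of the converse.
  have key : ∀ n : ℕ,
      (∀ m < n, a m = label (Order.pred (hT.top fun i : Fin N => a ((m : ℤ) - 1 - i)))) →
      hT.top (fun i : Fin N => a ((n : ℤ) - 1 - i))
        = Order.pred^[n] (hT.top fun i : Fin N => a (-1 - i)) := by
    intro n
    induction n with
    | zero => intro _; simp
    | succ n ih =>
      intro h
      have htail : Fin.tail (fun i : Fin (N + 1) => a ((n : ℤ) - i))
          = fun i : Fin N => a ((n : ℤ) - 1 - i) := by
        funext i
        simp only [Fin.tail, Fin.val_succ]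
        congr 1
        push_cast
        ring
      have hinit : Fin.init (fun i : Fin (N + 1) => a ((n : ℤ) - i))
          = fun i : Fin N => a (((n + 1 : ℕ) : ℤ) - 1 - i) := by
        funext i
        simp only [Fin.init, Fin.val_castSucc]
        congr 1
        push_cast
        ring
      have := hT.top_init (α := fun i : Fin (N + 1) => a ((n : ℤ) - i)) (by
        rw [htail, ← h n n.lt_succ_self]
        simp)
      rw [htail, hinit, ih fun m hm => h m (hm.trans n.lt_succ_self)] at this
      rw [this, Function.iterate_succ_apply']
  constructor
  · intro h n
    rw [h n, key n fun m _ => h m, ext, Function.iterate_succ_apply']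
  · intro h n
    induction n using Nat.strong_induction_on with
    | _ n ih => rw [h n, key n ih, ext, Function.iterate_succ_apply']

end IsNValid

end Tree

end Vilenkin

/-! ### Supports of the mask and of `φ̂` in terms of digits. -/

namespace Vilenkin

variable {p : ℕ} [Fact p.Prime]

/-- The digits of a character at the places `-1, …, -N`. -/
def low (N : ℕ) (χ : CharGroup p) (i : Fin N) : ZMod p := dig (-1 - i) χ

/-- The character with prescribed digits on a finite set of places and zero digits elsewhere. -/
def ofDigits (s : Finset ℤ) (a : ℤ → ZMod p) : CharGroup p := ∏ k ∈ s, r p k ^ (a k).val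

lemma dig_ofDigits (s : Finset ℤ) (a : ℤ → ZMod p) (k : ℤ) :
    dig k (ofDigits s a) = if k ∈ s then a k else 0 := by
  simp_rw [ofDigits, dig_prod, dig_pow, dig_r, ZMod.natCast_zmod_val, mul_ite, mul_one, mul_zero]
  rw [Finset.sum_ite_eq]

lemma inv_mul_mem_annih_iff {n : ℤ} {χ χ' : CharGroup p} :
    χ⁻¹ * χ' ∈ annih p n ↔ ∀ k ≥ n, dig k χ = dig k χ' := by
  simp_rw [mem_annih_iff, dig_mul, dig_inv, neg_add_eq_zero]

section Mask

variable {T : RootedTree} {label : T → ZMod p} {N : ℕ} {m₀ : CharGroup p → ℂ}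

lemma mem_treeSet_iff {χ : CharGroup p} (hχ : χ ∈ annih p 1) :
    χ ∈ treeSet T label N ↔ ((fun j : Fin (N + 1) => dig (-(j : ℤ)) χ) = 0 ∨
      ∃ v : Fin (N + 1) → T, IsPath v ∧ ∀ j : Fin (N + 1), label (v j) = dig (-(j : ℤ)) χ) := by
  have hdig : ∀ (v : Fin (N + 1) → T) (k : ℤ) (hk : -(N : ℤ) ≤ k),
      dig k (∏ j : Fin (N + 1), r p (-(j : ℤ)) ^ (label (v j)).val)
        = if h : k ≤ 0 then label (v ⟨(-k).toNat, by omega⟩) else 0 := by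
    intro v k hk
    simp_rw [dig_prod, dig_pow, dig_r, ZMod.natCast_zmod_val, mul_ite, mul_one, mul_zero]
    split_ifs with h
    · rw [Finset.sum_eq_single ⟨(-k).toNat, by omega⟩]
      · exact if_pos (by change k = -((-k).toNat : ℤ); omega)
      · intro j _ hj
        refine if_neg fun hkj => hj (Fin.ext ?_)
        change (j : ℕ) = (-k).toNat
        omega
      · simp
    · exact Finset.sum_eq_zero fun j _ => if_neg (by omega)
  refine or_congr ?_ (exists_congr fun v => and_congr_right fun _ => ?_)
  · rw [mem_annih_iff]
    constructor
    · intro h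
      funext j
      exact h _ (by omega)
    · intro h k hk
      by_cases hk0 : k ≤ 0
      · have := congrFun h ⟨(-k).toNat, by omega⟩
        simpa [Int.toNat_of_nonneg (show 0 ≤ -k by omega)] using this
      · exact mem_annih_iff.1 hχ k (by omega)
  · constructor
    · rintro ⟨ζ, hζ, h⟩ j
      rw [h, dig_mul, mem_annih_iff.1 hζ _ (by omega), zero_add, hdig v _ (by omega),
        dif_pos (by omega)]
      congr 2
      ext
      simp
    · intro h
      refine ⟨(∏ j : Fin (N + 1), r p (-(j : ℤ)) ^ (label (v j)).val)⁻¹ * χ,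
        inv_mul_mem_annih_iff.2 fun k hk => ?_, ?_⟩
      · rw [hdig v k hk]
        split_ifs with hk0
        · rw [h]
          congr 1
          change -((-k).toNat : ℤ) = k
          omega
        · exact (mem_annih_iff.1 hχ k (by omega)).symm
      · rw [mul_comm, mul_inv_cancel_left]

namespace IsGeneratedMask

variable (hm : IsGeneratedMask T label N m₀)
include hm

/-- The finitely many nonzero digits at places `≥ 1` are removed by a period of the mask, which
brings `χ` into `𝔊_1^⊥`, where the tree describes `m₀`. -/
lemma exists_trunc (χ : CharGroup p) :
    ∃ χ' ∈ annih p 1, m₀ χ' = m₀ χ ∧ ∀ k ≤ 0, dig k χ' = dig k χ := by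
  obtain ⟨n, hn⟩ := exists_mem_annih χ
  set ρ : CharGroup p := ∏ j ∈ Finset.Icc 1 n.toNat, r p (j : ℤ) ^ (dig j χ).val with hρ
  have hdig : ∀ k, dig k ρ = if 1 ≤ k then dig k χ else 0 := by
    intro k
    simp_rw [hρ, dig_prod, dig_pow, dig_r, ZMod.natCast_zmod_val, mul_ite, mul_one, mul_zero]
    split_ifs with hk
    · by_cases hkn : k ≤ n
      · rw [Finset.sum_eq_single k.toNat, if_pos (by omega), Int.toNat_of_nonneg (by omega)]
        · exact fun j _ hj => if_neg (by omega)
        · intro h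
          rw [Finset.mem_Icc] at h
          omega
      · rw [mem_annih_iff.1 hn k (by omega), Finset.sum_eq_zero]
        intro j hj
        rw [Finset.mem_Icc] at hj
        exact if_neg (by omega)
    · refine Finset.sum_eq_zero fun j hj => if_neg ?_
      rw [Finset.mem_Icc] at hj
      omega
  refine ⟨χ * ρ⁻¹, mem_annih_iff.2 fun k hk => ?_, ?_, fun k hk => ?_⟩
  · rw [dig_mul, dig_inv, hdig, if_pos hk, add_neg_cancel]
  · rw [← hm.periodic (χ * ρ⁻¹) n.toNat fun j => (dig j χ).val, ← hρ, inv_mul_cancel_right]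
  · rw [dig_mul, dig_inv, hdig, if_neg (by omega), neg_zero, add_zero]

lemma congr_of_dig_eq {χ χ' : CharGroup p}
    (h : ∀ k : ℤ, -N ≤ k → k ≤ 0 → dig k χ = dig k χ') : m₀ χ = m₀ χ' := by
  obtain ⟨χ₁, h₁, hm₁, hd₁⟩ := hm.exists_trunc χ
  obtain ⟨χ₂, h₂, hm₂, hd₂⟩ := hm.exists_trunc χ'
  rw [← hm₁, ← hm₂, ← hm.const_coset χ₁ (χ₁⁻¹ * χ₂), mul_comm, mul_inv_cancel_left]
  refine inv_mul_mem_annih_iff.2 fun k hk => ?_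
  by_cases hk0 : k ≤ 0
  · rw [hd₁ k hk0, hd₂ k hk0, h k hk hk0]
  · rw [mem_annih_iff.1 h₁ k (by omega), mem_annih_iff.1 h₂ k (by omega)]

variable [NeZero N] (hT : IsNValid T label N)

-- The mask is nonzero when the digits at `0, -1, …, -N` are all zero or read along a path, and
-- `isPath_iff` solves this condition for the digit at `0`.
open Classical in
lemma norm_eq (χ : CharGroup p) :
    ‖m₀ χ‖ = if dig 0 χ = label (Order.pred (hT.top (low N χ))) then 1 else 0 := by
  obtain ⟨χ', h1, hm', hd⟩ := hm.exists_trunc χ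
  have hiff := (mem_treeSet_iff (T := T) (label := label) (N := N) h1).trans
    (hT.isPath_iff fun j => dig (-(j : ℤ)) χ')
  have hlow : Fin.tail (fun j : Fin (N + 1) => dig (-(j : ℤ)) χ') = low N χ := by
    funext i
    rw [Fin.tail, hd _ (by omega), low]
    congr 1
    rw [Fin.val_succ]
    push_cast
    ring
  have h0 : dig (-((0 : Fin (N + 1)) : ℤ)) χ' = dig 0 χ := by
    rw [hd _ (by omega)]
    simp
  rw [hlow, h0] at hiff
  rw [← hm']
  split_ifs with h
  · exact hm.norm_eq_one _ (hiff.2 h)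
  · rw [hm.eq_zero _ h1 fun hmem => h (hiff.1 hmem), norm_zero]

omit [NeZero N] in
lemma eq_one_of_le {M : ℤ} {χ : CharGroup p} (hχ : χ ∈ annih p M) {n : ℕ} (hn : M + N ≤ n) :
    m₀ (charDilation (-(n : ℤ)) χ) = 1 :=
  hm.eq_one _ (charDilation_mem_annih.2 (annih_mono (by omega) hχ))

-- The infinite product is finite: `χ𝒜⁻ⁿ` has the digits of `χ` moved down by `n` places, so for `n
-- ≥ M + N` it lies in `𝔊_{-N}^⊥`, where the mask is `1`.
omit [NeZero N] in
lemma phiHat_eq_prod {M : ℤ} {χ : CharGroup p} (hχ : χ ∈ annih p M) {n : ℕ} (hn : M + N ≤ n) :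
    phiHat m₀ χ = ∏ k ∈ Finset.range n, m₀ (charDilation (-(k : ℤ)) χ) := by
  refine tprod_eq_prod fun k hk => hm.eq_one_of_le hχ ?_
  rw [Finset.mem_range] at hk
  omega

omit [NeZero N] in
/-- The refinement equation in the frequency domain. -/
lemma phiHat_refinement (χ : CharGroup p) :
    phiHat m₀ χ = m₀ χ * phiHat m₀ (charDilation (-1) χ) := by
  obtain ⟨M, hM⟩ := exists_mem_annih χ
  have hM' : charDilation (-1) χ ∈ annih p (M + 1) :=
    charDilation_mem_annih.2 (by simpa using annih_mono (by omega) hM)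
  rw [hm.phiHat_eq_prod hM (n := (M + N + 1).toNat + 1) (by omega),
    hm.phiHat_eq_prod hM' (n := (M + N + 1).toNat) (by omega), Finset.prod_range_succ', mul_comm]
  congr 1
  · simp [charDilation_zero]
  · refine Finset.prod_congr rfl fun k _ => ?_
    rw [charDilation_charDilation]
    congr 2
    push_cast
    ring

omit [NeZero N] in
lemma phiHat_mul {ζ : CharGroup p} (hζ : ζ ∈ annih p (-N)) (χ : CharGroup p) :
    phiHat m₀ (ζ * χ) = phiHat m₀ χ := by
  refine tprod_congr fun n => ?_
  rw [charDilation_mul]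
  exact hm.const_coset _ _ (charDilation_mem_annih.2 (annih_mono (by omega) hζ))

-- The `n`-th factor ties the digit at `n` to the `N` digits below it; `forall_eq_label_iff`
-- resolves this recursion in terms of the low word.
open Classical in
lemma norm_phiHat (χ : CharGroup p) :
    ‖phiHat m₀ χ‖ = if ∀ n : ℕ, dig n χ = hT.ext (low N χ) n then 1 else 0 := by
  have hiff := hT.forall_eq_label_iff fun k => dig k χ
  have hnorm : ∀ n : ℕ, ‖m₀ (charDilation (-(n : ℤ)) χ)‖ = if dig n χ
      = label (Order.pred (hT.top fun i : Fin N => dig ((n : ℤ) - 1 - i) χ)) then 1 else 0 := by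
    intro n
    rw [hm.norm_eq hT]
    have h1 : dig 0 (charDilation (-(n : ℤ)) χ) = dig n χ := by
      rw [dig_charDilation]
      simp
    have h2 : low N (charDilation (-(n : ℤ)) χ) = fun i : Fin N => dig ((n : ℤ) - 1 - i) χ := by
      funext i
      rw [low, dig_charDilation]
      congr 1
      ring
    rw [h1, h2]
  obtain ⟨M, hM⟩ := exists_mem_annih χ
  split_ifs with h
  · rw [hm.phiHat_eq_prod hM (n := (M + N).toNat) (by omega), norm_prod]
    refine Finset.prod_eq_one fun k _ => ?_
    rw [hnorm, if_pos (hiff.2 h k)]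
  · obtain ⟨k, hk⟩ := not_forall.1 fun h' => h (hiff.1 h')
    rw [hm.phiHat_eq_prod hM (n := max (M + N).toNat (k + 1)) (by omega), norm_prod]
    refine Finset.prod_eq_zero (i := k) (Finset.mem_range.2 (by omega)) ?_
    rw [hnorm, if_neg hk]

end IsGeneratedMask

end Mask

end Vilenkin

namespace Vilenkin

variable {p : ℕ} [Fact p.Prime]

/-! ### Finite Fourier analysis -/

section Fourier

variable {n : ℕ}

/-- The pairing of `(ℤ/p)^n` with itself. -/
def kernel (a d : Fin n → ZMod p) : ℂ := ZMod.toCircle (∑ i, a i * d i)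

lemma kernel_comm (a d : Fin n → ZMod p) : kernel a d = kernel d a := by
  simp_rw [kernel, mul_comm]

lemma sum_kernel (b : Fin n → ZMod p) :
    ∑ w, kernel b w = if b = 0 then (p : ℂ) ^ n else 0 := by
  classical
  let φ : (Fin n → ZMod p) →+ ZMod p :=
    { toFun := fun w => ∑ i, b i * w i
      map_zero' := by simp
      map_add' := fun v w => by simp [mul_add, Finset.sum_add_distrib] }
  let ψ : AddChar (Fin n → ZMod p) ℂ := ZMod.stdAddChar.compAddMonoidHom φ
  have hψ : ψ = 0 ↔ b = 0 := by
    constructor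
    · intro h
      funext i
      have h1 : ψ (Pi.single i 1) = 1 := by rw [h]; rfl
      refine toCircle_coe_injective ?_
      have h2 : φ (Pi.single i 1) = b i := by simp [φ, Pi.single_apply]
      simpa [ψ, AddChar.compAddMonoidHom_apply, h2, ZMod.stdAddChar_apply] using h1
    · rintro rfl
      ext w
      simp [ψ, φ, AddChar.compAddMonoidHom_apply]
  have := AddChar.sum_eq_ite ψ
  simp_rw [hψ] at this
  change ∑ w, kernel b w = _ at this
  rw [this]
  simp [ZMod.card]

lemma kernel_mul_conj (a b d : Fin n → ZMod p) :
    kernel a d * (starRingEnd ℂ) (kernel b d) = kernel (a - b) d := by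
  simp_rw [kernel, Pi.sub_apply, sub_mul, Finset.sum_sub_distrib, sub_eq_add_neg,
    AddChar.map_add_eq_mul, AddChar.map_neg_eq_inv, Circle.coe_mul, Circle.coe_inv_eq_conj]

lemma sum_kernel_mul_conj (a b : Fin n → ZMod p) :
    ∑ d, kernel a d * (starRingEnd ℂ) (kernel b d) = if a = b then (p : ℂ) ^ n else 0 := by
  simp_rw [kernel_mul_conj, sum_kernel, sub_eq_zero]

/-- Fourier inversion. -/
lemma fourier_inversion (u v : (Fin n → ZMod p) → ℂ) :
    (∀ d, u d = ∑ a, v a * (starRingEnd ℂ) (kernel a d)) ↔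
      ∀ a, v a = ((p : ℂ) ^ n)⁻¹ * ∑ d, u d * kernel a d := by
  have hp : (p : ℂ) ^ n ≠ 0 := pow_ne_zero _ (by exact_mod_cast (Fact.out : p.Prime).ne_zero)
  constructor
  · intro h a
    simp_rw [h, Finset.sum_mul]
    rw [Finset.sum_comm]
    simp_rw [mul_assoc, mul_comm ((starRingEnd ℂ) _), ← Finset.mul_sum, sum_kernel_mul_conj,
      mul_ite, mul_zero]
    rw [Finset.sum_ite_eq, if_pos (Finset.mem_univ _)]
    field_simp
  · intro h d
    have key : ∀ e, ∑ a, ((p : ℂ) ^ n)⁻¹ * (u e * kernel a e) * (starRingEnd ℂ) (kernel a d)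
        = ((p : ℂ) ^ n)⁻¹ * u e * if e = d then (p : ℂ) ^ n else 0 := fun e => by
      rw [← sum_kernel_mul_conj e d, Finset.mul_sum]
      refine Finset.sum_congr rfl fun a _ => ?_
      rw [kernel_comm a e, kernel_comm a d]
      ring
    simp_rw [h, Finset.mul_sum, Finset.sum_mul]
    rw [Finset.sum_comm]
    simp_rw [key, mul_ite, mul_zero]
    rw [Finset.sum_ite_eq', if_pos (Finset.mem_univ _)]
    field_simp

end Fourier

/-! ### The translation set -/

/-- The element `∑ a_j g_{-1-j}` of `H_0`. -/
def ofCoords {s : ℕ} (a : Fin s → ZMod p) : VilenkinGroup p :=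
  ∑ j : Fin s, (a j).val • g p (-((j : ℤ) + 1))

lemma coord_ofCoords {s : ℕ} (a : Fin s → ZMod p) (k : ℤ) :
    coord k (ofCoords a)
      = if h : k < 0 ∧ -(s : ℤ) ≤ k then a ⟨(-1 - k).toNat, by omega⟩ else 0 := by
  simp_rw [ofCoords, coord_sum, map_nsmul, coord_g, nsmul_eq_mul, ZMod.natCast_zmod_val, mul_ite,
    mul_one, mul_zero]
  split_ifs with h
  · rw [Finset.sum_eq_single ⟨(-1 - k).toNat, by omega⟩]
    · exact if_pos (by change k = -(((-1 - k).toNat : ℤ) + 1); omega)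
    · intro j _ hj
      refine if_neg fun hkj => hj (Fin.ext ?_)
      change (j : ℕ) = (-1 - k).toNat
      omega
    · simp
  · exact Finset.sum_eq_zero fun j _ => if_neg (by omega)

lemma coord_ofCoords_neg {s : ℕ} (a : Fin s → ZMod p) (i : Fin s) :
    coord (-1 - (i : ℤ)) (ofCoords a) = a i := by
  rw [coord_ofCoords, dif_pos (by omega)]
  congr 1
  ext
  change (-1 - (-1 - (i : ℤ))).toNat = (i : ℕ)
  omega

lemma ofCoords_injective {s : ℕ} :
    Function.Injective (ofCoords : (Fin s → ZMod p) → VilenkinGroup p) := fun a b h => by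
  funext i
  rw [← coord_ofCoords_neg a, h, coord_ofCoords_neg]

lemma mem_H0s_iff_exists {s : ℕ} {h : VilenkinGroup p} :
    h ∈ H0s p s ↔ ∃ a : Fin s → ZMod p, ofCoords a = h := by
  classical
  rw [H0s, Finset.mem_image]
  constructor
  · rintro ⟨a, -, rfl⟩
    refine ⟨fun j => ((a j : ℕ) : ZMod p), ?_⟩
    simp_rw [ofCoords, ZMod.val_cast_of_lt (a _).2]
  · rintro ⟨a, rfl⟩
    exact ⟨fun j => ⟨(a j).val, ZMod.val_lt _⟩, Finset.mem_univ _, rfl⟩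

lemma mem_H0s_iff {s : ℕ} {h : VilenkinGroup p} :
    h ∈ H0s p s ↔ (∀ k ≥ 0, coord k h = 0) ∧ h ∈ Gsub p (-s) := by
  rw [mem_H0s_iff_exists]
  constructor
  · rintro ⟨a, rfl⟩
    exact ⟨fun k hk => by rw [coord_ofCoords, dif_neg (by omega)],
      fun k hk => by rw [coord_ofCoords, dif_neg (by omega)]⟩
  · rintro ⟨h0, hs⟩
    refine ⟨fun i => coord (-1 - (i : ℤ)) h, ext_coord fun k => ?_⟩
    rw [coord_ofCoords]
    split_ifs with hk
    · congr 2
      change -1 - ((-1 - k).toNat : ℤ) = k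
      omega
    · by_cases hk0 : 0 ≤ k
      · exact (h0 k hk0).symm
      · exact (hs k (by omega)).symm

lemma mem_H0_iff {h : VilenkinGroup p} : h ∈ H0 p ↔ ∀ k ≥ 0, coord k h = 0 := by
  constructor
  · rintro ⟨s, hs⟩
    exact (mem_H0s_iff.1 hs).1
  · intro h0
    obtain ⟨n, hn⟩ := exists_mem_Gsub h
    exact ⟨n.natAbs, mem_H0s_iff.2 ⟨h0, Gsub_anti (by omega) hn⟩⟩

/-- The coordinates of the elements of `H_0^{(s)}`. -/
def coordsEquiv (p : ℕ) [Fact p.Prime] (s : ℕ) : (Fin s → ZMod p) ≃ H0s p s :=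
  Equiv.ofBijective (fun a => ⟨ofCoords a, mem_H0s_iff_exists.2 ⟨a, rfl⟩⟩)
    ⟨fun _ _ h => ofCoords_injective (congrArg Subtype.val h), fun ⟨_, hh⟩ => by
      obtain ⟨a, ha⟩ := mem_H0s_iff_exists.1 hh
      exact ⟨a, Subtype.ext ha⟩⟩

lemma coe_coordsEquiv {s : ℕ} (a : Fin s → ZMod p) : (coordsEquiv p s a : VilenkinGroup p)
    = ofCoords a := rfl

lemma card_H0s (s : ℕ) : Fintype.card (H0s p s) = p ^ s := by
  rw [← Fintype.card_congr (coordsEquiv p s)]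
  simp [ZMod.card]

lemma pair_ofCoords {s : ℕ} (χ : CharGroup p) (a : Fin s → ZMod p) :
    pair χ (ofCoords a) = kernel a (low s χ) := by
  rw [ofCoords, pair_sum, kernel, toCircle_sum]
  refine Finset.prod_congr rfl fun k _ => ?_
  rw [pair_nsmul, pair_g, ← Circle.coe_pow, ← AddChar.map_nsmul_eq_pow, nsmul_eq_mul,
    ZMod.natCast_zmod_val, low]
  congr 4
  ring

/-! ### Mask coefficients -/

/-- The digits of `χ𝒜⁻¹` at `-1, …, -n` are those of `χ` at `0, …, -(n-1)`; for `n = N + 1` this is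
the window seen by the mask. -/
lemma exists_low_charDilation_eq {n : ℕ} (d : Fin n → ZMod p) :
    ∃ χ : CharGroup p, low n (charDilation (-1) χ) = d := by
  refine ⟨ofDigits (Finset.Icc (-(n : ℤ)) 0)
    (fun k => if h : (-k).toNat < n then d ⟨(-k).toNat, h⟩ else 0), ?_⟩
  funext i
  rw [low, dig_charDilation, dig_ofDigits, if_pos (by rw [Finset.mem_Icc]; omega),
    dif_pos (by omega)]
  congr 1
  ext
  change (-(-1 - (i : ℤ) - -1)).toNat = (i : ℕ)
  omega

lemma isMaskCoeff_iff {N : ℕ} {m : CharGroup p → ℂ} {β : H0s p (N + 1) → ℂ} :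
    IsMaskCoeff N m β ↔ ∀ χ, (p : ℂ) * m χ = ∑ a, β (coordsEquiv p (N + 1) a) *
      (starRingEnd ℂ) (kernel a (low (N + 1) (charDilation (-1) χ))) := by
  have hp : (p : ℂ) ≠ 0 := by exact_mod_cast (Fact.out : p.Prime).ne_zero
  refine forall_congr' fun χ => ?_
  rw [← Equiv.sum_comp (coordsEquiv p (N + 1))]
  simp_rw [coe_coordsEquiv, pair_ofCoords]
  rw [one_div, eq_inv_mul_iff_mul_eq₀ hp]

/-- Such an `m` is just a function on `(ℤ/p)^{N+1}`, and the coefficients are its Fourier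
coefficients up to the factor `p`. -/
lemma existsUnique_isMaskCoeff {N : ℕ} {m : CharGroup p → ℂ}
    (hm : ∀ χ χ', (∀ k : ℤ, -N ≤ k → k ≤ 0 → dig k χ = dig k χ') → m χ = m χ') :
    ∃! β : H0s p (N + 1) → ℂ, IsMaskCoeff N m β := by
  choose ρ hρ using exists_low_charDilation_eq (p := p) (n := N + 1)
  have hm' : ∀ χ, m χ = m (ρ (low (N + 1) (charDilation (-1) χ))) := fun χ => by
    refine hm _ _ fun k hk hk0 => ?_
    have := congrFun (hρ (low (N + 1) (charDilation (-1) χ))) ⟨(-k).toNat, by omega⟩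
    simp only [low, dig_charDilation] at this
    rw [show -1 - ((-k).toNat : ℤ) - -1 = k by omega] at this
    exact this.symm
  have key : ∀ β : H0s p (N + 1) → ℂ, IsMaskCoeff N m β ↔
      ∀ a, β (coordsEquiv p (N + 1) a) = ((p : ℂ) ^ (N + 1))⁻¹ *
        ∑ d, (p * m (ρ d)) * kernel a d := by
    intro β
    rw [isMaskCoeff_iff, ← fourier_inversion (fun d => p * m (ρ d))
      (fun a => β (coordsEquiv p (N + 1) a))]
    constructor
    · intro h d
      rw [h, hρ]
    · intro h χ
      rw [hm', h]
  refine ⟨fun h => ((p : ℂ) ^ (N + 1))⁻¹ *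
    ∑ d, (p * m (ρ d)) * kernel ((coordsEquiv p (N + 1)).symm h) d, ?_, ?_⟩
  · refine (key _).2 fun a => ?_
    simp only [Equiv.symm_apply_apply]
  · intro β hβ
    funext h
    simpa using (key β).1 hβ ((coordsEquiv p (N + 1)).symm h)

lemma IsMaskCoeff.shifted {N : ℕ} {m₀ : CharGroup p → ℂ} {β : H0s p (N + 1) → ℂ}
    (hβ : IsMaskCoeff N m₀ β) (l : ℕ) :
    IsMaskCoeff N (shiftedMask m₀ l) (shiftedCoeff β l) := fun χ => by
  rw [shiftedMask, hβ]
  congr 1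
  refine Finset.sum_congr rfl fun h _ => ?_
  rw [shiftedCoeff, charDilation_mul, pair_mul, pair_charDilation (-1) (r p 0 ^ l)⁻¹, pair_inv,
    map_mul, Complex.conj_conj]
  ring

end Vilenkin

/-! ### Functions supported on digit graphs and their translates. -/

namespace Vilenkin

variable {p : ℕ} [Fact p.Prime]

/-- The inverse Fourier transform. -/
def invFourier (f : CharGroup p → ℂ) (x : VilenkinGroup p) : ℂ := ∫ χ, f χ * pair χ x ∂(haarX p)

/-- `f` is constant on the cosets of `𝔊_{-N}^⊥`, of absolute value one where the digits at places
`n ≥ 0` are the function `d` of the digits at the places `-1, …, -N`, and zero elsewhere. -/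
structure IsDigitGraph (N : ℕ) (f : CharGroup p → ℂ) (d : (Fin N → ZMod p) → ℕ → ZMod p) :
    Prop where
  const : ∀ χ, ∀ ζ ∈ annih p (-N), f (ζ * χ) = f χ
  norm_eq_one : ∀ χ, (∀ n : ℕ, dig n χ = d (low N χ) n) → ‖f χ‖ = 1
  eq_zero : ∀ χ, ¬ (∀ n : ℕ, dig n χ = d (low N χ) n) → f χ = 0
  bound : ∃ K, ∀ w n, K ≤ n → d w n = 0

/-- A character with given digits at the places `k ≥ -N`. -/
lemma exists_low_eq {N : ℕ} (w : Fin N → ZMod p) (d : ℕ → ZMod p) (hd : ∃ K, ∀ n, K ≤ n → d n = 0) :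
    ∃ χ : CharGroup p, low N χ = w ∧ ∀ n : ℕ, dig n χ = d n := by
  obtain ⟨K, hK⟩ := hd
  refine ⟨ofDigits (Finset.Ico (-(N : ℤ)) K) fun k =>
    if 0 ≤ k then d k.toNat else if h : (-1 - k).toNat < N then w ⟨(-1 - k).toNat, h⟩ else 0,
    ?_, fun n => ?_⟩
  · funext i
    rw [low, dig_ofDigits, if_pos (by rw [Finset.mem_Ico]; omega), if_neg (by omega),
      dif_pos (by omega)]
    congr 1
    ext
    change (-1 - (-1 - (i : ℤ))).toNat = (i : ℕ)
    omega
  · rw [dig_ofDigits, if_pos (by omega : (0 : ℤ) ≤ n), Int.toNat_natCast]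
    split_ifs with h
    · rfl
    · rw [Finset.mem_Ico] at h
      exact (hK n (by omega)).symm

lemma inv_mul_mem_annih_neg_iff {N : ℕ} {χ χ' : CharGroup p} :
    χ⁻¹ * χ' ∈ annih p (-N) ↔ low N χ = low N χ' ∧ ∀ n : ℕ, dig n χ = dig n χ' := by
  rw [inv_mul_mem_annih_iff]
  constructor
  · intro h
    exact ⟨funext fun i => h _ (by omega), fun n => h _ (by omega)⟩
  · rintro ⟨h1, h2⟩ k hk
    by_cases hk0 : 0 ≤ k
    · have := h2 k.toNat
      rwa [Int.toNat_of_nonneg hk0] at this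
    · have := congrFun h1 ⟨(-1 - k).toNat, by omega⟩
      simp only [low] at this
      rwa [show -1 - ((-1 - k).toNat : ℤ) = k by omega] at this

/-- The support is one coset of `𝔊_{-N}^⊥` for each low word `w`, represented by `σ w`. -/
lemma IsDigitGraph.exists_isStep {N : ℕ} {f : CharGroup p → ℂ}
    {d : (Fin N → ZMod p) → ℕ → ZMod p} (h : IsDigitGraph N f d) :
    ∃ σ : (Fin N → ZMod p) → CharGroup p, IsStep (-N) f σ ∧ (∀ w, low N (σ w) = w) ∧
      (∀ w (n : ℕ), dig n (σ w) = d w n) ∧ ∀ w, ‖f (σ w)‖ = 1 := by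
  obtain ⟨K, hK⟩ := h.bound
  choose σ hlow hdig using fun w => exists_low_eq w (d w) ⟨K, hK w⟩
  refine ⟨σ, ⟨h.const, fun χ hχ => ⟨low N χ, ?_⟩, fun w w' hw => ?_⟩, hlow, hdig,
    fun w => h.norm_eq_one _ fun n => by rw [hdig, hlow]⟩
  · by_contra hn
    refine hχ (h.eq_zero χ fun hd => hn ?_)
    exact inv_mul_mem_annih_neg_iff.2 ⟨hlow _, fun n => by rw [hdig, hd]⟩
  · have := (inv_mul_mem_annih_neg_iff.1 hw).1
    rwa [hlow, hlow] at this

lemma IsDigitGraph.memLp {N : ℕ} {f : CharGroup p → ℂ} {d : (Fin N → ZMod p) → ℕ → ZMod p}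
    (h : IsDigitGraph N f d) : MemLp (invFourier f) 2 (haarG p) := by
  obtain ⟨σ, hσ, -⟩ := h.exists_isStep
  rw [show invFourier f = _ from funext hσ.integral]
  exact memLp_stepFun _ _ _

section

variable {ι κ : Type*} [Fintype ι] [Fintype κ] {M : ℤ}

/-- The inner product of translates of `stepFun`s. -/
lemma integral_translates_stepFun_of_notMem {h h' : VilenkinGroup p} (hh : h - h' ∉ Gsub p M)
    (c : ι → ℂ) (σ : ι → CharGroup p) (d : κ → ℂ) (τ : κ → CharGroup p) :
    ∫ x, (starRingEnd ℂ) (stepFun M c σ (x - h)) * stepFun M d τ (x - h') ∂(haarG p) = 0 := by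
  refine integral_eq_zero_of_ae (.of_forall fun x => ?_)
  by_cases hx : x - h ∈ Gsub p M
  · have hx' : x - h' ∉ Gsub p M := fun hx' => hh (by
      rw [show h - h' = (x - h') - (x - h) by abel]
      exact sub_mem hx' hx)
    simp [stepFun, hx']
  · simp [stepFun, hx]

lemma integral_translates_stepFun_of_mem {h h' : VilenkinGroup p} (hh : h - h' ∈ Gsub p M)
    (c : ι → ℂ) (σ : ι → CharGroup p) (d : κ → ℂ) (τ : κ → CharGroup p)
    [∀ i j, Decidable ((σ i)⁻¹ * τ j ∈ annih p M)] :
    ∫ x, (starRingEnd ℂ) (stepFun M c σ (x - h)) * stepFun M d τ (x - h') ∂(haarG p)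
      = (p : ℂ) ^ M * ∑ i, ∑ j, if (σ i)⁻¹ * τ j ∈ annih p M
        then (starRingEnd ℂ) (c i) * (d j * pair (τ j) (h - h')) else 0 := by
  rw [← integral_conj_stepFun_mul_stepFun, ← integral_sub_right_eq_self (μ := haarG p)
    (fun x => (starRingEnd ℂ) (stepFun M c σ x) *
      stepFun M (fun j => d j * pair (τ j) (h - h')) τ x) h]
  refine integral_congr_ae (.of_forall fun x => ?_)
  simp only
  rw [← stepFun_add_of_mem hh, sub_add_sub_cancel]

end

/-- A common coset would have one low word and two different digits at `0`, so the supports in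
frequency are disjoint. -/
lemma IsDigitGraph.integral_translates_eq_zero {N : ℕ} {f f' : CharGroup p → ℂ}
    {d d' : (Fin N → ZMod p) → ℕ → ZMod p} (hf : IsDigitGraph N f d) (hf' : IsDigitGraph N f' d')
    (hd : ∀ w, d w 0 ≠ d' w 0) (h h' : VilenkinGroup p) :
    ∫ x, (starRingEnd ℂ) (invFourier f (x - h)) * invFourier f' (x - h') ∂(haarG p) = 0 := by
  classical
  obtain ⟨σ, hσ, hlow, hdig, -⟩ := hf.exists_isStep
  obtain ⟨σ', hσ', hlow', hdig', -⟩ := hf'.exists_isStep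
  rw [show invFourier f = _ from funext hσ.integral, show invFourier f' = _ from funext hσ'.integral]
  by_cases hh : h - h' ∈ Gsub p (-N)
  · rw [integral_translates_stepFun_of_mem hh, Finset.sum_eq_zero, mul_zero]
    refine fun i _ => Finset.sum_eq_zero fun j _ => if_neg fun hij => ?_
    obtain ⟨h1, h2⟩ := inv_mul_mem_annih_neg_iff.1 hij
    rw [hlow, hlow'] at h1
    subst h1
    exact hd i (by rw [← hdig, h2, hdig'])
  · exact integral_translates_stepFun_of_notMem hh _ _ _ _

open Classical in
lemma IsDigitGraph.integral_translates {N : ℕ} {f : CharGroup p → ℂ}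
    {d : (Fin N → ZMod p) → ℕ → ZMod p} (hf : IsDigitGraph N f d)
    {h h' : VilenkinGroup p} (hh : h ∈ H0 p) (hh' : h' ∈ H0 p) :
    ∫ x, (starRingEnd ℂ) (invFourier f (x - h)) * invFourier f (x - h') ∂(haarG p)
      = if h = h' then 1 else 0 := by
  have hp : (p : ℂ) ≠ 0 := by exact_mod_cast (Fact.out : p.Prime).ne_zero
  obtain ⟨σ, hσ, hlow, hdig, hnorm⟩ := hf.exists_isStep
  rw [show invFourier f = _ from funext hσ.integral]
  by_cases hmem : h - h' ∈ Gsub p (-N)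
  · obtain ⟨a, ha⟩ := mem_H0s_iff_exists.1 (mem_H0s_iff.2 ⟨fun k hk => by
      rw [map_sub, mem_H0_iff.1 hh k hk, mem_H0_iff.1 hh' k hk, sub_zero], hmem⟩)
    have ha0 : a = 0 ↔ h = h' := by
      rw [← sub_eq_zero (a := h), ← ha, ← (ofCoords_injective (p := p) (s := N)).eq_iff]
      have : ofCoords (0 : Fin N → ZMod p) = 0 := by simp [ofCoords]
      rw [this]
    rw [integral_translates_stepFun_of_mem hmem]
    -- Distinct low words give distinct cosets, so only `j = i` survives. Since `h - h'` involves
    -- only `g_{-1}, …, g_{-N}`, its pairing with `σ i` depends on the low word alone, and what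
    -- remains is a sum of `kernel a` over all words.
    have key : ∀ i, (∑ j, if (σ i)⁻¹ * σ j ∈ annih p (-N)
        then (starRingEnd ℂ) (f (σ i)) * (f (σ j) * pair (σ j) (h - h')) else 0)
          = kernel a i := by
      intro i
      rw [Finset.sum_eq_single i]
      · rw [if_pos (by rw [inv_mul_cancel]; exact (annihSubgroup p _).one_mem), ← mul_assoc,
          Complex.conj_mul', hnorm, ← ha, pair_ofCoords, hlow]
        simp
      · exact fun j _ hj => if_neg fun hij => hj (hσ.inj _ _ hij).symm
      · simp
    simp_rw [key, sum_kernel, ha0]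
    split_ifs
    · rw [zpow_neg, zpow_natCast, inv_mul_cancel₀ (pow_ne_zero _ hp)]
    · rw [mul_zero]
  · rw [integral_translates_stepFun_of_notMem hmem, if_neg]
    rintro rfl
    exact hmem (by rw [sub_self]; exact zero_mem _)

/-! ### The refinable function and the wavelets -/

section Wavelets

variable {T : RootedTree} {label : T → ZMod p} {N : ℕ} {m₀ : CharGroup p → ℂ}

/-- The Fourier transform `m_l(χ) φ̂(χ𝒜⁻¹)` of the `l`-th wavelet. -/
def psiHat (m₀ : CharGroup p → ℂ) (l : ℕ) (χ : CharGroup p) : ℂ :=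
  shiftedMask m₀ l χ * phiHat m₀ (charDilation (-1) χ)

lemma low_charDilation (χ : CharGroup p) :
    low N (charDilation (-1) χ) = Fin.init (Fin.cons (dig 0 χ) (low N χ) : Fin (N + 1) → ZMod p) := by
  have : (fun i : Fin (N + 1) => dig (-(i : ℤ)) χ) = Fin.cons (dig 0 χ) (low N χ) := by
    funext i
    refine Fin.cases ?_ (fun j => ?_) i
    · simp
    · rw [Fin.cons_succ, low, Fin.val_succ]
      congr 1
      push_cast
      ring
  rw [← this]
  funext i
  rw [low, dig_charDilation, Fin.init, Fin.val_castSucc]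
  congr 1
  ring

namespace IsGeneratedMask

variable (hm : IsGeneratedMask T label N m₀)
include hm

variable [NeZero N] (hT : IsNValid T label N)

lemma isDigitGraph_phiHat : IsDigitGraph N (phiHat m₀) hT.ext where
  const χ _ hζ := hm.phiHat_mul hζ χ
  norm_eq_one χ h := by rw [hm.norm_phiHat hT, if_pos h]
  eq_zero χ h := norm_eq_zero.1 (by rw [hm.norm_phiHat hT, if_neg h])
  bound := hT.exists_ext_eq_zero

omit hm in
/-- The digits of the support of `psiHat m₀ l`. -/
def _root_.Vilenkin.IsNValid.psiExt (l : ℕ) (w : Fin N → ZMod p) : ℕ → ZMod p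
  | 0 => hT.ext w 0 + l
  | n + 1 => hT.ext (Fin.init (Fin.cons (hT.ext w 0 + l) w : Fin (N + 1) → ZMod p)) n

-- Multiplication by `r_0^{-l}` changes only the digit at `0`, so `m_l` forces that digit to be `ext
-- + l`; the factor `φ̂(χ𝒜⁻¹)` then determines all digits at places `≥ 1`.
open Classical in
lemma norm_psiHat (l : ℕ) (χ : CharGroup p) :
    ‖psiHat m₀ l χ‖ = if ∀ n : ℕ, dig n χ = hT.psiExt l (low N χ) n then 1 else 0 := by
  have hlow : low N (χ * (r p 0 ^ l)⁻¹) = low N χ := by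
    funext i
    rw [low, dig_mul, dig_inv, dig_pow, dig_r, if_neg (by omega), mul_zero, neg_zero, add_zero, low]
  have h0 : dig 0 (χ * (r p 0 ^ l)⁻¹) = dig 0 χ - l := by
    rw [dig_mul, dig_inv, dig_pow, dig_r, if_pos rfl, mul_one, sub_eq_add_neg]
  rw [psiHat, norm_mul, shiftedMask, hm.norm_eq hT, hm.norm_phiHat hT, ite_mul, one_mul,
    zero_mul, ← ite_and, hlow, h0]
  refine if_congr ?_ rfl rfl
  change (dig 0 χ - l = hT.ext (low N χ) 0 ∧ _) ↔ _
  rw [sub_eq_iff_eq_add]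
  have hd : ∀ n : ℕ, dig n (charDilation (-1) χ) = dig ((n + 1 : ℕ) : ℤ) χ := fun n => by
    rw [dig_charDilation, sub_neg_eq_add, Nat.cast_succ]
  simp_rw [hd, low_charDilation]
  constructor
  · rintro ⟨h1, h2⟩ n
    cases n with
    | zero => exact h1
    | succ n => rw [h2 n, h1]; rfl
  · intro h
    have h1 : dig 0 χ = hT.ext (low N χ) 0 + l := h 0
    exact ⟨h1, fun n => by rw [h (n + 1), h1]; rfl⟩

lemma isDigitGraph_psiHat (l : ℕ) : IsDigitGraph N (psiHat m₀ l) (hT.psiExt l) where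
  const χ ζ hζ := by
    rw [psiHat, psiHat, shiftedMask, shiftedMask, mul_assoc, hm.const_coset _ _ hζ, charDilation_mul,
      hm.phiHat_mul (charDilation_mem_annih.2 (annih_mono (by omega) hζ))]
  norm_eq_one χ h := by rw [hm.norm_psiHat hT, if_pos h]
  eq_zero χ h := norm_eq_zero.1 (by rw [hm.norm_psiHat hT, if_neg h])
  bound := by
    obtain ⟨K, hK⟩ := hT.exists_ext_eq_zero
    refine ⟨K + 1, fun w n hn => ?_⟩
    cases n with
    | zero => omega
    | succ n => exact hK _ n (by omega)

-- This is the refinement equation; it makes `φ` the wavelet with `l = 0`, treated together with the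
-- others below.
omit [NeZero N] in
lemma psiHat_zero : psiHat m₀ 0 = phiHat m₀ := by
  funext χ
  rw [hm.phiHat_refinement χ, psiHat, shiftedMask, pow_zero, inv_one, mul_one]

include hT in
lemma exists_isStep_phiHat : ∃ σ : (Fin N → ZMod p) → CharGroup p, IsStep (-N) (phiHat m₀) σ :=
  (hm.isDigitGraph_phiHat hT).exists_isStep.imp fun _ h => h.1

omit hm [NeZero N] in
lemma _root_.Vilenkin.IsStep.charDilation {ι : Type*} {M : ℤ} {f : CharGroup p → ℂ}
    {σ : ι → CharGroup p} (hf : IsStep M f σ) :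
    IsStep (M + 1) (fun χ => f (charDilation (-1) χ)) (fun i => charDilation 1 (σ i)) where
  const χ ζ hζ := by
    rw [charDilation_mul]
    exact hf.const _ _ (charDilation_mem_annih.2 (annih_mono (by omega) hζ))
  supp χ hχ := by
    obtain ⟨i, hi⟩ := hf.supp _ hχ
    refine ⟨i, ?_⟩
    have h1 : (Vilenkin.charDilation 1 (σ i))⁻¹ * χ
        = Vilenkin.charDilation 1 ((σ i)⁻¹ * Vilenkin.charDilation (-1) χ) := by
      rw [charDilation_mul, charDilation_charDilation, add_neg_cancel, charDilation_zero]
      rfl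
    rw [h1, charDilation_mem_annih]
    simpa using hi
  inj i j hij := by
    refine hf.inj i j ?_
    have h1 : (Vilenkin.charDilation 1 (σ i))⁻¹ * Vilenkin.charDilation 1 (σ j)
        = Vilenkin.charDilation 1 ((σ i)⁻¹ * σ j) := rfl
    rw [h1, charDilation_mem_annih] at hij
    simpa using hij

omit hm [NeZero N] in
/-- The inverse Fourier transform of a dilation. -/
lemma _root_.Vilenkin.IsStep.invFourier_charDilation {ι : Type*} [Fintype ι] {M : ℤ}
    {f : CharGroup p → ℂ} {σ : ι → CharGroup p} (hf : IsStep M f σ) (x : VilenkinGroup p) :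
    invFourier (fun χ => f (charDilation (-1) χ)) x = p * invFourier f (dilation p 1 x) := by
  classical
  have hp : (p : ℂ) ≠ 0 := by exact_mod_cast (Fact.out : p.Prime).ne_zero
  have hx : dilation p 1 x ∈ Gsub p M ↔ x ∈ Gsub p (M + 1) := by
    simp_rw [mem_Gsub, coord_dilation]
    exact ⟨fun h k hk => by simpa using h (k - 1) (by omega), fun h k hk => h _ (by omega)⟩
  rw [invFourier, invFourier, hf.integral, hf.charDilation.integral]
  simp_rw [stepFun, Set.indicator_apply, SetLike.mem_coe, hx, charDilation_charDilation,
    neg_add_cancel, charDilation_zero, pair_charDilation]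
  split_ifs
  · rw [zpow_add_one₀ hp]
    ring
  · rw [mul_zero]

include hT in
/-- The functions `ψ` are the inverse Fourier transforms of `m(χ) φ̂(χ𝒜⁻¹)`. -/
lemma psi_eq_invFourier {m : CharGroup p → ℂ} {b : H0s p (N + 1) → ℂ} (hb : IsMaskCoeff N m b)
    (x : VilenkinGroup p) :
    psi (phi m₀) b x = invFourier (fun χ => m χ * phiHat m₀ (charDilation (-1) χ)) x := by
  have hp : (p : ℂ) ≠ 0 := by exact_mod_cast (Fact.out : p.Prime).ne_zero
  obtain ⟨σ, hσ⟩ := hm.exists_isStep_phiHat hT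
  have h1 : ∀ χ, m χ * phiHat m₀ (charDilation (-1) χ) * pair χ x
      = ∑ h : H0s p (N + 1), ((p : ℂ)⁻¹ * b h) *
        (phiHat m₀ (charDilation (-1) χ) * pair χ (x - dilation p (-1) h)) := fun χ => by
    rw [hb χ, one_div, Finset.mul_sum, Finset.sum_mul, Finset.sum_mul]
    refine Finset.sum_congr rfl fun h _ => ?_
    rw [pair_sub, pair_charDilation]
    ring
  simp_rw [invFourier, h1]
  rw [integral_finsetSum _ fun h _ => (hσ.charDilation.integrable _).const_mul _, psi]
  refine Finset.sum_congr rfl fun h _ => ?_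
  rw [integral_const_mul]
  have h2 := hσ.invFourier_charDilation (x - dilation p (-1) h)
  rw [map_sub, ← dilation_add, add_neg_cancel, dilation_zero, invFourier] at h2
  rw [h2, mul_comm (p : ℂ)⁻¹, mul_assoc, inv_mul_cancel_left₀ hp]
  rfl

end IsGeneratedMask

end Wavelets

end Vilenkin

/-! ### Orthonormality and completeness of the wavelets in `L₂(𝔊)`. -/

namespace Vilenkin

/-- An orthonormal family in `V₁ ⊓ V₀ᗮ` that together with a family spanning `V₀` spans `V₁` is a
Hilbert basis of `V₁ ⊓ V₀ᗮ`. -/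
lemma exists_hilbertBasis_inf_orthogonal {E ι κ : Type*} [NormedAddCommGroup E]
    [InnerProductSpace ℂ E] [CompleteSpace E] {V₀ V₁ : Submodule ℂ E} {v₀ : κ → E} {v₁ : ι → E}
    (hV₀ : V₀ = (Submodule.span ℂ (Set.range v₀)).topologicalClosure)
    (hclosed : IsClosed (V₁ : Set E))
    (hV₁ : V₁ ≤ (Submodule.span ℂ (Set.range v₀ ∪ Set.range v₁)).topologicalClosure)
    (hv₁ : ∀ i, v₁ i ∈ V₁) (hon : Orthonormal ℂ v₁) (hort : ∀ k i, inner ℂ (v₀ k) (v₁ i) = 0) :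
    ∃ b : HilbertBasis ι ℂ ↥(V₁ ⊓ V₀ᗮ), ∀ i, (b i : E) = v₁ i := by
  have : CompleteSpace ↥(V₁ ⊓ V₀ᗮ) :=
    (hclosed.inter V₀.isClosed_orthogonal).completeSpace_coe
  have hmem : ∀ i, v₁ i ∈ V₁ ⊓ V₀ᗮ := fun i => by
    refine ⟨hv₁ i, ?_⟩
    change v₁ i ∈ V₀ᗮ
    rw [hV₀, Submodule.orthogonal_closure, Submodule.mem_orthogonal]
    intro u hu
    rw [← Submodule.mem_orthogonal_singleton_iff_inner_left]
    refine Submodule.span_le.2 ?_ hu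
    rintro _ ⟨k, rfl⟩
    exact Submodule.mem_orthogonal_singleton_iff_inner_left.2 (hort k i)
  let w : ι → ↥(V₁ ⊓ V₀ᗮ) := fun i => ⟨v₁ i, hmem i⟩
  have hw : Orthonormal ℂ w := by
    classical
    exact orthonormal_iff_ite.2 fun i j => orthonormal_iff_ite.1 hon i j
  refine ⟨HilbertBasis.mkOfOrthogonalEqBot hw ?_, fun i => by
    rw [HilbertBasis.coe_mkOfOrthogonalEqBot]⟩
  rw [Submodule.eq_bot_iff]
  rintro ⟨x, hx1, hx0⟩ hx
  refine Subtype.ext (?_ : x = 0)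
  -- A vector `x` of `V₁ ⊓ V₀ᗮ` orthogonal to the family is orthogonal to everything that spans
  -- `V₁`, hence to itself.
  have hall : ∀ u ∈ V₁, inner ℂ u x = 0 := by
    intro u hu
    have hsub : (Submodule.span ℂ (Set.range v₀ ∪ Set.range v₁)).topologicalClosure ≤ (ℂ ∙ x)ᗮ := by
      refine Submodule.topologicalClosure_minimal _ (Submodule.span_le.2 ?_)
        (Submodule.isClosed_orthogonal _)
      rintro _ (⟨k, rfl⟩ | ⟨i, rfl⟩)
      · refine Submodule.mem_orthogonal_singleton_iff_inner_left.2
          ((Submodule.mem_orthogonal _ _).1 hx0 _ ?_)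
        rw [hV₀]
        exact Submodule.le_topologicalClosure _ (Submodule.subset_span ⟨k, rfl⟩)
      · exact Submodule.mem_orthogonal_singleton_iff_inner_left.2
          ((Submodule.mem_orthogonal _ _).1 hx (w i) (Submodule.subset_span ⟨i, rfl⟩))
    exact Submodule.mem_orthogonal_singleton_iff_inner_left.1 (hsub (hV₁ hu))
  exact inner_self_eq_zero.1 (hall x hx1)

/-- An orthonormal family in the span of at most as many vectors has the same span. -/
lemma span_range_eq_of_orthonormal {E ι κ : Type*} [NormedAddCommGroup E] [InnerProductSpace ℂ E]
    [Fintype ι] [Fintype κ] {v : ι → E} {u : κ → E} (hv : Orthonormal ℂ v)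
    (hcard : Fintype.card κ ≤ Fintype.card ι) (hmem : ∀ i, v i ∈ Submodule.span ℂ (Set.range u)) :
    Submodule.span ℂ (Set.range v) = Submodule.span ℂ (Set.range u) := by
  have : FiniteDimensional ℂ (Submodule.span ℂ (Set.range u)) :=
    FiniteDimensional.span_of_finite ℂ (Set.finite_range u)
  refine Submodule.eq_of_le_of_finrank_le (Submodule.span_le.2 (Set.range_subset_iff.2 hmem)) ?_
  rw [finrank_span_eq_card hv.linearIndependent]
  exact (finrank_range_le_card u).trans hcard

variable {p : ℕ} [Fact p.Prime]

lemma V_eq_closure_span {φ : VilenkinGroup p → ℂ} {n : ℤ} (e : H0 p → L2 p)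
    (he : ∀ h : H0 p, e h =ᵐ[haarG p] fun x => φ (dilation p n x - h)) :
    V φ n = (Submodule.span ℂ (Set.range e)).topologicalClosure := by
  rw [V]
  congr 2
  ext f
  constructor
  · rintro ⟨h, hh, hf⟩
    exact ⟨⟨h, hh⟩, Lp.ext ((he _).trans hf.symm)⟩
  · rintro ⟨h, rfl⟩
    exact ⟨h, h.2, he h⟩

lemma isClosed_V (φ : VilenkinGroup p → ℂ) (n : ℤ) : IsClosed (V φ n : Set (L2 p)) :=
  Submodule.isClosed_topologicalClosure _

namespace IsGeneratedMask

variable {T : RootedTree} {label : T → ZMod p} {N : ℕ} {m₀ : CharGroup p → ℂ}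
  (hm : IsGeneratedMask T label N m₀) [NeZero N] (hT : IsNValid T label N)

include hm hT in
lemma memLp_phi_dilation (h : VilenkinGroup p) :
    MemLp (fun x => phi m₀ (dilation p 1 x - h)) 2 (haarG p) := by
  have hp : (p : ℂ) ≠ 0 := by exact_mod_cast (Fact.out : p.Prime).ne_zero
  obtain ⟨σ, hσ⟩ := hm.exists_isStep_phiHat hT
  have h1 : MemLp (invFourier fun χ => phiHat m₀ (charDilation (-1) χ)) 2 (haarG p) := by
    rw [show invFourier _ = _ from funext hσ.charDilation.integral]
    exact memLp_stepFun _ _ _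
  -- `φ(𝒜x - h)` is `p⁻¹` times the translate by `𝒜⁻¹h` of the inverse transform of `φ̂(χ𝒜⁻¹)`, so
  -- the effect of `𝒜` on `μ` is not needed.
  convert (memLp_comp_sub h1 (dilation p (-1) h)).const_mul (p : ℂ)⁻¹ using 2 with x
  rw [hσ.invFourier_charDilation, map_sub, ← dilation_add, add_neg_cancel, dilation_zero,
    inv_mul_cancel_left₀ hp]
  rfl

/-- The function `φ(𝒜x - h)` in `L₂(𝔊)`. -/
def phiDilate (h : VilenkinGroup p) : L2 p := (hm.memLp_phi_dilation hT h).toLp _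

/-- The function `ψ_l(x - h)` in `L₂(𝔊)`. -/
def wavelet (l : ℕ) (h : VilenkinGroup p) : L2 p :=
  (memLp_comp_sub (hm.isDigitGraph_psiHat hT l).memLp h).toLp _

lemma coeFn_phiDilate (h : VilenkinGroup p) :
    hm.phiDilate hT h =ᵐ[haarG p] fun x => phi m₀ (dilation p 1 x - h) := MemLp.coeFn_toLp _

lemma coeFn_wavelet (l : ℕ) (h : VilenkinGroup p) :
    hm.wavelet hT l h =ᵐ[haarG p] fun x => invFourier (psiHat m₀ l) (x - h) := MemLp.coeFn_toLp _

lemma coeFn_wavelet_eq_psi {β : H0s p (N + 1) → ℂ} (hβ : IsMaskCoeff N m₀ β) (l : ℕ)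
    (h : VilenkinGroup p) :
    hm.wavelet hT l h =ᵐ[haarG p] fun x => psi (phi m₀) (shiftedCoeff β l) (x - h) := by
  refine (hm.coeFn_wavelet hT l h).trans (.of_forall fun x => ?_)
  exact (hm.psi_eq_invFourier hT (hβ.shifted l) (x - h)).symm

lemma coeFn_wavelet_zero (h : VilenkinGroup p) :
    hm.wavelet hT 0 h =ᵐ[haarG p] fun x => phi m₀ (x - h) := by
  refine (hm.coeFn_wavelet hT 0 h).trans (.of_forall fun x => ?_)
  simp only [hm.psiHat_zero]
  rfl

lemma orthonormal_wavelet :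
    Orthonormal ℂ fun i : Fin p × H0 p => hm.wavelet hT i.1 (i.2 : VilenkinGroup p) := by
  classical
  have hinner : ∀ (l l' : ℕ) (h h' : VilenkinGroup p),
      inner ℂ (hm.wavelet hT l h) (hm.wavelet hT l' h')
        = ∫ x, (starRingEnd ℂ) (invFourier (psiHat m₀ l) (x - h)) *
            invFourier (psiHat m₀ l') (x - h') ∂(haarG p) := by
    intro l l' h h'
    rw [L2.inner_def]
    refine integral_congr_ae ?_
    filter_upwards [hm.coeFn_wavelet hT l h, hm.coeFn_wavelet hT l' h'] with x hx hx'
    rw [hx, hx', RCLike.inner_apply, mul_comm]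
  rw [orthonormal_iff_ite]
  rintro ⟨l, h⟩ ⟨l', h'⟩
  rw [hinner]
  rcases eq_or_ne l l' with rfl | hne
  · rw [(hm.isDigitGraph_psiHat hT l).integral_translates h.2 h'.2]
    simp [Subtype.ext_iff]
  · rw [(hm.isDigitGraph_psiHat hT l).integral_translates_eq_zero
      (hm.isDigitGraph_psiHat hT l'), if_neg (fun h => hne (congrArg Prod.fst h))]
    -- At place `0` the two graphs have the digits `ext + l` and `ext + l'`, and `l`, `l'` are below
    -- `p`.
    intro w hw
    have h1 : ((l : ℕ) : ZMod p) = (l' : ℕ) := add_left_cancel hw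
    rw [ZMod.natCast_eq_natCast_iff', Nat.mod_eq_of_lt l.2, Nat.mod_eq_of_lt l'.2] at h1
    exact hne (Fin.ext h1)

variable {β : H0s p (N + 1) → ℂ} (hβ : IsMaskCoeff N m₀ β)

-- The defining sum of `ψ_l`, translated: `𝒜(x - h) - k = 𝒜x - (𝒜h + k)`.
include hβ in
lemma wavelet_eq_sum (l : ℕ) (h : VilenkinGroup p) :
    hm.wavelet hT l h = ∑ k : H0s p (N + 1),
      shiftedCoeff β l k • hm.phiDilate hT (dilation p 1 h + k) := by
  refine Lp.ext ((hm.coeFn_wavelet_eq_psi hT hβ l h).trans ?_)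
  refine Filter.EventuallyEq.trans ?_ (Lp.coeFn_finsetSum _ _).symm
  have h1 : ∀ᵐ x ∂(haarG p), ∀ k : H0s p (N + 1),
      (shiftedCoeff β l k • hm.phiDilate hT (dilation p 1 h + k) : L2 p) x
        = shiftedCoeff β l k * phi m₀ (dilation p 1 x - (dilation p 1 h + k)) := by
    refine ae_all_iff.2 fun k => ?_
    filter_upwards [Lp.coeFn_smul (shiftedCoeff β l k) (hm.phiDilate hT (dilation p 1 h + k)),
      hm.coeFn_phiDilate hT (dilation p 1 h + k)] with x hx hx'
    rw [hx, Pi.smul_apply, hx', smul_eq_mul]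
  filter_upwards [h1] with x hx
  rw [Finset.sum_apply, psi]
  refine Finset.sum_congr rfl fun k _ => ?_
  rw [hx k, map_sub, sub_sub]

-- `𝒜` maps `H_0^{(s)}` into `H_0^{(s+1)}`, and `N ≤ s` puts `H_0^{(N+1)}` there too, so all the
-- translates `𝒜h + k` stay in `H_0^{(s+1)}`.
include hβ in
lemma wavelet_mem_span {s : ℕ} (hs : N ≤ s) (l : ℕ) {h : VilenkinGroup p} (hh : h ∈ H0s p s) :
    hm.wavelet hT l h ∈ Submodule.span ℂ
      (Set.range fun k : H0s p (s + 1) => hm.phiDilate hT (k : VilenkinGroup p)) := by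
  rw [hm.wavelet_eq_sum hT hβ]
  refine Submodule.sum_mem _ fun k _ => Submodule.smul_mem _ _ (Submodule.subset_span ⟨⟨_, ?_⟩, rfl⟩)
  obtain ⟨h0, h1⟩ := mem_H0s_iff.1 hh
  obtain ⟨k0, k1⟩ := mem_H0s_iff.1 k.2
  refine mem_H0s_iff.2 ⟨fun j hj => ?_, fun j hj => ?_⟩
  · rw [map_add, coord_dilation, h0 _ (by omega), k0 _ hj, add_zero]
  · push_cast at hj
    rw [map_add, coord_dilation, h1 _ (by omega), k1 _ (by push_cast; omega), add_zero]

-- The dimension count: `p · p^{s+N}` orthonormal vectors inside the span of `p^{s+N+1}` vectors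
-- exhaust it. The level is raised from `s` to `s + N` to meet the condition of `wavelet_mem_span`.
include hβ in
lemma phiDilate_mem_span (h : H0 p) :
    hm.phiDilate hT (h : VilenkinGroup p) ∈ Submodule.span ℂ
      (Set.range fun i : Fin p × H0 p => hm.wavelet hT i.1 (i.2 : VilenkinGroup p)) := by
  obtain ⟨h, s, hs⟩ := h
  have hh : h ∈ H0s p (s + N + 1) :=
    mem_H0s_iff.2 ⟨(mem_H0s_iff.1 hs).1, Gsub_anti (by push_cast; omega) (mem_H0s_iff.1 hs).2⟩
  have hinj : Function.Injective fun i : Fin p × H0s p (s + N) =>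
      ((i.1, ⟨i.2, s + N, i.2.2⟩) : Fin p × H0 p) := by
    rintro ⟨l, k⟩ ⟨l', k'⟩ hk
    exact Prod.ext (congrArg (fun i : Fin p × H0 p => i.1) hk)
      (Subtype.ext (congrArg (fun i : Fin p × H0 p => (i.2 : VilenkinGroup p)) hk))
  have heq := span_range_eq_of_orthonormal ((hm.orthonormal_wavelet hT).comp _ hinj)
    (u := fun k : H0s p (s + N + 1) => hm.phiDilate hT (k : VilenkinGroup p))
    (by rw [Fintype.card_prod, Fintype.card_fin, card_H0s, card_H0s, pow_succ'])
    (fun i => hm.wavelet_mem_span hT hβ (by omega) _ i.2.2)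
  refine Submodule.span_mono (Set.range_comp_subset_range _ _) (heq.ge ?_)
  exact Submodule.subset_span ⟨⟨h, hh⟩, rfl⟩

lemma V_zero_eq : V (phi m₀) 0 = (Submodule.span ℂ
    (Set.range fun h : H0 p => hm.wavelet hT 0 (h : VilenkinGroup p))).topologicalClosure :=
  V_eq_closure_span _ fun h => by
    simp_rw [dilation_zero]
    exact hm.coeFn_wavelet_zero hT h

lemma V_one_eq : V (phi m₀) 1 = (Submodule.span ℂ
    (Set.range fun h : H0 p => hm.phiDilate hT (h : VilenkinGroup p))).topologicalClosure :=
  V_eq_closure_span _ fun h => hm.coeFn_phiDilate hT h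

include hβ in
lemma wavelet_mem_V_one (l : ℕ) (h : H0 p) :
    hm.wavelet hT l (h : VilenkinGroup p) ∈ V (phi m₀) 1 := by
  obtain ⟨h, s, hs⟩ := h
  have hh : h ∈ H0s p (s + N) :=
    mem_H0s_iff.2 ⟨(mem_H0s_iff.1 hs).1, Gsub_anti (by push_cast; omega) (mem_H0s_iff.1 hs).2⟩
  rw [hm.V_one_eq hT]
  refine Submodule.le_topologicalClosure _ (Submodule.span_mono ?_
    (hm.wavelet_mem_span hT hβ (by omega) l hh))
  rintro _ ⟨k, rfl⟩
  exact ⟨⟨k, _, k.2⟩, rfl⟩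

include hm hT hβ in
lemma V_zero_le_V_one : V (phi m₀) 0 ≤ V (phi m₀) 1 := by
  rw [hm.V_zero_eq hT]
  refine Submodule.topologicalClosure_minimal _ (Submodule.span_le.2 ?_) (isClosed_V _ _)
  rintro _ ⟨h, rfl⟩
  exact hm.wavelet_mem_V_one hT hβ 0 h

include hβ in
lemma V_one_le : V (phi m₀) 1 ≤ (Submodule.span ℂ
    (Set.range (fun h : H0 p => hm.wavelet hT 0 (h : VilenkinGroup p)) ∪
      Set.range fun i : Set.Icc 1 (p - 1) × H0 p =>
        hm.wavelet hT i.1 (i.2 : VilenkinGroup p))).topologicalClosure := by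
  rw [hm.V_one_eq hT]
  refine Submodule.topologicalClosure_mono (Submodule.span_le.2 ?_)
  rintro _ ⟨h, rfl⟩
  refine Submodule.span_mono ?_ (hm.phiDilate_mem_span hT hβ h)
  rintro _ ⟨⟨l, k⟩, rfl⟩
  rcases Nat.eq_zero_or_pos (l : ℕ) with hl | hl
  · exact Or.inl ⟨k, by simp only [hl]⟩
  · exact Or.inr ⟨(⟨l, hl, by omega⟩, k), rfl⟩

include hβ in
lemma exists_hilbertBasis : ∃ b : HilbertBasis (Set.Icc 1 (p - 1) × H0 p) ℂ (W (phi m₀) 0),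
    ∀ i, (b i : L2 p) = hm.wavelet hT i.1 (i.2 : VilenkinGroup p) := by
  have hp := (Fact.out : p.Prime).pos
  have hon := hm.orthonormal_wavelet hT
  refine exists_hilbertBasis_inf_orthogonal (hm.V_zero_eq hT) (isClosed_V _ _)
    (hm.V_one_le hT hβ) (fun i => hm.wavelet_mem_V_one hT hβ _ _) ?_ ?_
  · refine hon.comp (fun i : Set.Icc 1 (p - 1) × H0 p =>
      ((⟨i.1, by have := i.1.2.2; omega⟩, i.2) : Fin p × H0 p)) ?_
    rintro ⟨l, k⟩ ⟨l', k'⟩ hk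
    simpa [Subtype.ext_iff, Fin.ext_iff] using hk
  · rintro k ⟨l, k'⟩
    refine hon.2 (i := (⟨0, hp⟩, k)) (j := (⟨l, by have := l.2.2; omega⟩, k')) fun h => ?_
    have h1 : 0 = (l : ℕ) := congrArg (fun i : Fin p × H0 p => (i.1 : ℕ)) h
    have := l.2.1
    omega

end IsGeneratedMask

end Vilenkin

end

theorem theorem5p1 (p : ℕ) [Fact p.Prime] (N : ℕ) (hN : 1 ≤ N)
    (T : RootedTree) (label : T → ZMod p) (hT : IsNValid T label N)
    (m₀ : CharGroup p → ℂ) (hm : IsGeneratedMask T label N m₀) :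
    MemLp (phi m₀) 2 (haarG p) ∧
    V (phi m₀) 0 ≤ V (phi m₀) 1 ∧
    (∃! β : H0s p (N + 1) → ℂ, IsMaskCoeff N m₀ β) ∧
    ∀ β : H0s p (N + 1) → ℂ, IsMaskCoeff N m₀ β →
      (∀ l ∈ Set.Icc 1 (p - 1), IsMaskCoeff N (shiftedMask m₀ l) (shiftedCoeff β l)) ∧
      ∃ b : HilbertBasis (Set.Icc 1 (p - 1) × H0 p) ℂ (W (phi m₀) 0),
        ∀ (l : Set.Icc 1 (p - 1)) (h : H0 p),
          ((b (l, h) : L2 p) : VilenkinGroup p → ℂ) =ᵐ[haarG p]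
            fun x => psi (phi m₀) (shiftedCoeff β l) (x - h) := by
  have : NeZero N := ⟨by omega⟩
  have hex := existsUnique_isMaskCoeff fun χ χ' h => hm.congr_of_dig_eq (χ := χ) (χ' := χ') h
  obtain ⟨β₀, hβ₀, -⟩ := id hex
  refine ⟨(hm.isDigitGraph_phiHat hT).memLp, hm.V_zero_le_V_one hT hβ₀, hex, fun β hβ => ?_⟩
  refine ⟨fun l _ => hβ.shifted l, ?_⟩
  obtain ⟨b, hb⟩ := hm.exists_hilbertBasis hT hβ
  exact ⟨b, fun l h => by
    rw [hb]
    exact hm.coeFn_wavelet_eq_psi hT hβ l h⟩
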